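/- Let $\mathbb k$ be a field of characteristic zero, $\bar A$ a commutative unital $\mathbb k$-algebra with derivations $\mathfrak X(\bar A)=\mathrm{Der}_{\mathbb k}(\bar A)$, $I\subset\bar A$ an ideal, and put $\mathfrak X(\bar A,I)=\{X\mid X(I)\subset I\}$ and $\mathfrak X_0=\{X\mid X(\bar A)\subset I\}$. Let $F\subset\mathfrak X(\bar A,I)$ be a subset, let $k\ge 1$, and let $\omega\in \mathrm{CE}^{k+1}(\mathfrak X(\bar A))$ (an $\bar A$-multilinear alternating form on $\mathfrak X(\bar A)$) be closed for the Chevalley–Eilenberg differential $d$, with $$\omega\big(F,\mathfrak X(\bar A,I),\dots,\mathfrak X(\bar A,I)\big)\subset I .$$ A constraint object is a triple $(T,W,N)$ with $N\subset W\subset T$; a constraint multilinear map sends tuples from $W$ to $W$, and to $N$ as soon as one argument lies in $N$. Let $\mathcal F$ be the smallest $\bar A$-submodule of $\mathfrak X(\bar A)$ that is closed under the Lie bracket and contains $F$ and $\mathfrak X_0$. Define the triples * $A'=\big(\bar A,\ \{f\mid \mathcal F(f)\subset I\},\ I\big)$; * $\mathfrak Y=\big(\mathfrak X(\bar A),\ \{X\in\mathfrak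 X(\bar A,I)\mid[\mathcal F,X]\subset\mathcal F\},\ \mathcal F\big)$; * $B=\mathrm{CE}(\mathfrak X(\bar A))$ with $B_N$ the forms taking values in $I$ on all tuples from $\mathfrak X(\bar A,I)$, and $B_W$ the forms taking values in $I$ on tuples from $\mathfrak X(\bar A,I)$ with at least one entry in $\mathfrak X_0$; * the basic forms $B'=\big(B,\ \{\alpha\in B_W\mid \iota_X\alpha,\ \mathcal L_X\alpha\in B_N\ \text{for all }X\in\mathcal F\},\ B_N\big)$, where $\iota_X$ is insertion into the leftmost slot and $\mathcal L_X=\iota_Xd+d\iota_X$. Let $\mathrm{Ham}(B',\omega)=\bigoplus_{i\le 0}\mathrm{Ham}^i(B',\omega)$ be the constraint graded vector space with total space $$\mathrm{Ham}^0=\{(\alpha,X)\in \mathrm{CE}^{k-1}(\mathfrak X(\bar A))\oplus\mathfrak X(\bar A)\mid \iota_X\omega=-d\alpha\},\qquad \mathrm{Ham}^i=\mathrm{CE}^{k-1+i}(\mathfrak X(\bar A))\quad(i<0),$$ whose $W$- and $N$-parts consist of the elements with $\alpha\in B'_W$, $X\in\mathfrak Y_W$, respectively $\alpha\in B'_N$,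 $X\in\mathfrak Y_N$. Then: 1. $A'$ is a strong constraint algebra and $\mathfrak Y$ is a strong constraint Lie–Rinehart algebra over $A'$ (bracket, module multiplication and the identity anchor are constraint maps, and $I\,\mathfrak X(\bar A)\subset\mathcal F$, $\bar A\,\mathcal F\subset\mathcal F$). 2. $B'$ is a graded constraint triple that is a constraint Cartan calculus over $\mathfrak Y$: $d$, $\iota$, $\mathcal L$ satisfy the usual Cartan commutation rules, and $d$, multiplication by elements of $A'$, and $\iota_X$, $\mathcal L_X$ for $X\in\mathfrak Y$ are constraint maps. 3. If moreover $\omega\in B_W$, then $\iota_X\omega\in B_N$ for all $X\in\mathcal F$. 4. There is a constraint $L_\infty$-algebra structure on $\mathrm{Ham}(B',\omega)$ (cohomological convention, $l_j$ of degree $2-j$, generalized Jacobi identities $\sum_{i+j=n+1}\sum_{\sigma\in \mathrm{Sh}(i,n-i)}(-1)^{i(j-1)}\chi(\sigma;x)\,l_j(l_i(x_{\sigma(1)},\dots,x_{\sigma(i)}),x_{\sigma(i+1)},\dots,x_{\sigma(n)})=0$, where $\chi$ is the antisymmetric Koszul sign), whose brackets are: $l_1(\alpha)=d\alpha$ in degrees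 $<-1$, $l_1(\alpha)=(d\alpha,0)$ in degree $-1$, $l_1=0$ in degree $0$; on elements of degree $0$ $$l_2\big((\alpha,X),(\beta,Y)\big)=\big(-\iota_X\iota_Y\omega,\ [X,Y]\big),\qquad l_j\big((\alpha_1,X_1),\dots,(\alpha_j,X_j)\big)=(-1)^{j+1}\iota_{X_1}\cdots\iota_{X_j}\omega\quad(j\ge3);$$ and $l_j$, $j\ge 2$, vanishes if some argument has nonzero degree. 5. In particular these brackets induce an $L_\infty$-algebra structure on the graded quotient $\mathrm{Ham}(B',\omega)_W/\mathrm{Ham}(B',\omega)_N$, the reduced algebra of observables. -/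

import Mathlib

open scoped DirectSum

namespace ConstraintReduction

/-! ### Constraint vector spaces

A constraint vector space with total space `T` is given by subspaces `N ≤ W` of `T`.  The triple is
stored without the inclusion; the inclusion is part of each predicate below. -/

/-- The data of a triple `(T, W, N)` with `W` and `N` subspaces of the total space `T`. -/
structure ConstraintTriple (𝕜 T : Type*) [Field 𝕜] [AddCommGroup T] [Module 𝕜 T] where
  W : Submodule 𝕜 T
  N : Submodule 𝕜 T

/-- `S` is a graded subspace for the grading `𝒢`: it is the sum of its homogeneous parts. -/
def IsGradedSubspace {𝕜 T ι : Type*} [Field 𝕜] [AddCommGroup T] [Module 𝕜 T]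
    (𝒢 : ι → Submodule 𝕜 T) (S : Submodule 𝕜 T) : Prop :=
  S = ⨆ i, S ⊓ 𝒢 i

/-- The reduced space `W / N` (for `N ≤ W`). -/
abbrev ConstraintTriple.Red {𝕜 T : Type*} [Field 𝕜] [AddCommGroup T] [Module 𝕜 T]
    (C : ConstraintTriple 𝕜 T) : Type _ :=
  ↥C.W ⧸ C.N.comap C.W.subtype

/-- The grading of the reduced space `W / N` induced by a grading of the total space. -/
def ConstraintTriple.redGrading {𝕜 T ι : Type*} [Field 𝕜] [AddCommGroup T] [Module 𝕜 T]
    (C : ConstraintTriple 𝕜 T) (𝒢 : ι → Submodule 𝕜 T) (i : ι) : Submodule 𝕜 C.Red :=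
  ((𝒢 i).comap C.W.subtype).map (C.N.comap C.W.subtype).mkQ

/-! ### `L∞`-algebras -/

/-- The antisymmetric Koszul sign `χ(σ; x) = sgn(σ) ε(σ; x)` for elements of degrees `d`, so that
`x₁ ∧ ⋯ ∧ xₙ = χ(σ; x) x_{σ 1} ∧ ⋯ ∧ x_{σ n}` : each inversion `a < b`, `σ b < σ a` contributes
`-(-1)^{|x_{σ a}| |x_{σ b}|}`. -/
def koszulSign {n : ℕ} (σ : Equiv.Perm (Fin n)) (d : Fin n → ℤ) : ℤˣ :=
  ∏ q ∈ Finset.univ.filter (fun q : Fin n × Fin n => q.1 < q.2 ∧ σ q.2 < σ q.1),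
    -Int.negOnePow (d (σ q.1) * d (σ q.2))

/-- The `(i, n - i)`-unshuffles: `σ 1 < ⋯ < σ i` and `σ (i + 1) < ⋯ < σ n`. -/
def unshuffles (n i : ℕ) : Finset (Equiv.Perm (Fin n)) :=
  Finset.univ.filter fun σ =>
    ∀ a b : Fin n, a < b → ((b : ℕ) < i ∨ i ≤ (a : ℕ)) → σ a < σ b

/-- An `L∞`-algebra structure on the `ℤ`-graded vector space `L = ⨁ i, 𝒢 i` (cohomological
convention): graded antisymmetric multibrackets `l n` of degree `2 - n`, `n ≥ 1`, with
`∑_{i + j = n + 1} ∑_{σ ∈ Sh(i, n - i)} (-1)^{i (j - 1)} χ(σ; x)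
  l_j (l_i (x_{σ 1}, …, x_{σ i}), x_{σ (i + 1)}, …, x_{σ n}) = 0`.
The brackets are multilinear maps on the total space. -/
structure LInftyAlgebra (𝕜 : Type*) {L : Type*} [Field 𝕜] [AddCommGroup L] [Module 𝕜 L]
    (𝒢 : ℤ → Submodule 𝕜 L) where
  isInternal : DirectSum.IsInternal 𝒢
  bracket : ∀ n : ℕ, MultilinearMap 𝕜 (fun _ : Fin n => L) L
  bracket_zero : bracket 0 = 0
  degree : ∀ (n : ℕ) (d : Fin n → ℤ) (x : Fin n → L), (∀ a, x a ∈ 𝒢 (d a)) →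
    bracket n x ∈ 𝒢 (∑ a, d a + 2 - n)
  antisymm : ∀ (n : ℕ) (d : Fin n → ℤ) (x : Fin n → L) (σ : Equiv.Perm (Fin n)),
    (∀ a, x a ∈ 𝒢 (d a)) → bracket n (fun a => x (σ a)) = koszulSign σ d • bracket n x
  /-- In the outer sum the number of inputs of the inner bracket is `i = p + 1`. -/
  jacobi : ∀ (n : ℕ) (d : Fin n → ℤ) (x : Fin n → L), (∀ a, x a ∈ 𝒢 (d a)) →
    ∑ p : Fin n, ∑ σ ∈ unshuffles n (p + 1),
      (-1 : ℤ) ^ (((p : ℕ) + 1) * (n - (p + 1))) • koszulSign σ d •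
        bracket (n - (p + 1) + 1)
          (Fin.cons (bracket (p + 1) fun a : Fin (p + 1) => x (σ ⟨a, by omega⟩))
            fun b : Fin (n - (p + 1)) => x (σ ⟨p + 1 + b, by omega⟩)) = 0

/-- The triple `C` makes the `L∞`-algebra `L` on its total space a constraint `L∞`-algebra. -/
structure IsConstraintLInfty {𝕜 T : Type*} [Field 𝕜] [AddCommGroup T] [Module 𝕜 T]
    {𝒢 : ℤ → Submodule 𝕜 T} (L : LInftyAlgebra 𝕜 𝒢) (C : ConstraintTriple 𝕜 T) : Prop where
  le : C.N ≤ C.W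
  graded_W : IsGradedSubspace 𝒢 C.W
  graded_N : IsGradedSubspace 𝒢 C.N
  bracket_W : ∀ (n : ℕ) (x : Fin n → T), (∀ a, x a ∈ C.W) → L.bracket n x ∈ C.W
  bracket_N : ∀ (n : ℕ) (x : Fin n → T), (∀ a, x a ∈ C.W) → ∀ a, x a ∈ C.N →
    L.bracket n x ∈ C.N

/-! ### The Chevalley–Eilenberg (de Rham) algebra of the derivations of `A` -/

section CE

variable (𝕜 A : Type*) [Field 𝕜] [CommRing A] [Algebra 𝕜 A]

/-- `CE^n(𝔛(A))`, the `A`-linear dual of `Λ^n_A 𝔛(A)`. -/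
abbrev Form (n : ℕ) : Type _ := (Derivation 𝕜 A A) [⋀^Fin n]→ₗ[A] A

instance (n : ℕ) : IsScalarTower 𝕜 A (Form 𝕜 A n) where
  smul_assoc c a α := by
    ext X
    simp

/-- `CE(𝔛(A)) = ⨁ n, CE^n(𝔛(A))`. -/
def CE : Type _ := ⨁ n : ℕ, Form 𝕜 A n

instance : AddCommGroup (CE 𝕜 A) := inferInstanceAs (AddCommGroup (⨁ n : ℕ, Form 𝕜 A n))

instance : Module 𝕜 (CE 𝕜 A) := inferInstanceAs (Module 𝕜 (⨁ n : ℕ, Form 𝕜 A n))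

instance : Module A (CE 𝕜 A) := inferInstanceAs (Module A (⨁ n : ℕ, Form 𝕜 A n))

/-- The component of degree `n` of an element of `CE(𝔛(A))`. -/
def CE.comp (n : ℕ) : CE 𝕜 A →ₗ[A] Form 𝕜 A n := DirectSum.component A ℕ (Form 𝕜 A) n

/-- The inclusion of `CE^n(𝔛(A))` in `CE(𝔛(A))`. -/
def CE.of (n : ℕ) : Form 𝕜 A n →ₗ[A] CE 𝕜 A := DirectSum.lof A ℕ (Form 𝕜 A) n

instance : IsScalarTower 𝕜 A (CE 𝕜 A) where
  smul_assoc c a α := by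
    refine DFinsupp.ext fun n => ?_
    change (c • a) • CE.comp 𝕜 A n α = c • a • CE.comp 𝕜 A n α
    rw [smul_assoc]

variable {𝕜 A}

/-- The sum over pairs in the Chevalley–Eilenberg differential,
`∑_{p < q} (-1)^{p + q} α([X_p, X_q], X_0, …, X̂_p, …, X̂_q, …)`.
Pairs `p < q` are encoded by `i ≤ j` via `p = i`, `q = j + 1`. -/
def ceBracketSum : ∀ {n : ℕ}, Form 𝕜 A n → (Fin (n + 1) → Derivation 𝕜 A A) → A
  | 0, _, _ => 0
  | n + 1, α, X => ∑ i : Fin (n + 1), ∑ j ≥ i,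
      (-1 : ℤ) ^ ((i.castSucc : ℕ) + (j.succ : ℕ)) •
        α (Matrix.vecCons ⁅X i.castSucc, X j.succ⁆ (j.removeNth (i.castSucc.removeNth X)))

/-- The value of the Chevalley–Eilenberg differential of `α` at `X_0, …, X_n`. -/
def ceDiffFun {n : ℕ} (α : Form 𝕜 A n) (X : Fin (n + 1) → Derivation 𝕜 A A) : A :=
  ∑ i : Fin (n + 1), (-1 : ℤ) ^ (i : ℕ) • X i (α (i.removeNth X)) + ceBracketSum α X

section construction

/-- Auxiliary: `α` as a `𝕜`-alternating map. -/
def restrictForm {n : ℕ} (α : Form 𝕜 A n) : (Derivation 𝕜 A A) [⋀^Fin n]→ₗ[𝕜] A where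
  toMultilinearMap := α.toMultilinearMap.restrictScalars 𝕜
  map_eq_zero_of_eq' := α.map_eq_zero_of_eq'

@[simp]
theorem restrictForm_apply {n : ℕ} (α : Form 𝕜 A n) (X : Fin n → Derivation 𝕜 A A) :
    restrictForm α X = α X := rfl

/-- Auxiliary: `X ↦ X ∘ α`, `𝕜`-linear in `X`, with values in `𝕜`-alternating maps. -/
def anchorAux {n : ℕ} (α : Form 𝕜 A n) :
    Derivation 𝕜 A A →ₗ[𝕜] (Derivation 𝕜 A A) [⋀^Fin n]→ₗ[𝕜] A where
  toFun X := (X : A →ₗ[𝕜] A).compAlternatingMap (restrictForm α)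
  map_add' X Y := by ext; simp
  map_smul' c X := by ext; simp

/-- Auxiliary: `(X, Y) ↦ α([X, Y], …)`, `𝕜`-bilinear in `X, Y`. -/
def bracketAux {n : ℕ} (α : Form 𝕜 A (n + 1)) :
    Derivation 𝕜 A A →ₗ[𝕜] Derivation 𝕜 A A →ₗ[𝕜]
      (Derivation 𝕜 A A) [⋀^Fin n]→ₗ[𝕜] A :=
  LinearMap.mk₂ 𝕜 (fun X Y => restrictForm (α.curryLeft ⁅X, Y⁆))
    (fun X X' Y => by ext; simp) (fun c X Y => by ext; simp)
    (fun X Y Y' => by ext; simp) (fun c X Y => by ext; simp)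

theorem removeNth_succ_vecCons {T : Type*} {n : ℕ} (i : Fin (n + 1)) (X : T)
    (Y : Fin (n + 1) → T) :
    i.succ.removeNth (Matrix.vecCons X Y) = Matrix.vecCons X (i.removeNth Y) := by
  ext a
  cases a using Fin.cases <;> simp [Fin.removeNth]

theorem removeNth_zero_vecCons {T : Type*} {n : ℕ} (X : T) (Y : Fin n → T) :
    (0 : Fin (n + 1)).removeNth (Matrix.vecCons X Y) = Y := by
  ext a
  simp [Fin.removeNth]

/-- `A`-linearity of the Chevalley–Eilenberg differential in its first slot. -/
theorem ceDiffFun_cons_smul {n : ℕ} (α : Form 𝕜 A n) (f : A) (X : Derivation 𝕜 A A)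
    (Y : Fin n → Derivation 𝕜 A A) :
    ceDiffFun α (Matrix.vecCons (f • X) Y) = f * ceDiffFun α (Matrix.vecCons X Y) := by
  cases n with
  | zero => simp [ceDiffFun, ceBracketSum]
  | succ n =>
    have hinner : ∀ (i : Fin n) (j : Fin (n + 1)), j ≥ i.succ → ∀ (Z X : Derivation 𝕜 A A),
        α (Matrix.vecCons Z (j.removeNth (i.succ.castSucc.removeNth
          (Matrix.vecCons (f • X) Y)))) =
        f * α (Matrix.vecCons Z (j.removeNth (i.succ.castSucc.removeNth
          (Matrix.vecCons X Y)))) := by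
      intro i j hj Z X
      cases n with
      | zero => exact i.elim0
      | succ n =>
        obtain ⟨j, rfl⟩ := Fin.exists_succ_eq.2 (show j ≠ 0 by
          rintro rfl
          simp at hj)
        have h := AlternatingMap.map_vecCons_smul (α.curryLeft Z)
          (j.removeNth (i.castSucc.removeNth Y)) f X
        simpa [← Fin.succ_castSucc, removeNth_succ_vecCons] using h
    have hlie : ∀ j, ⁅f • X, Y j⁆ = f • ⁅X, Y j⁆ - (Y j f) • X := by
      intro j
      ext a
      simp [Derivation.commutator_apply]
      ring
    have hb : ceBracketSum α (Matrix.vecCons (f • X) Y) =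
        f * ceBracketSum α (Matrix.vecCons X Y) +
          ∑ j : Fin (n + 1), (-1 : ℤ) ^ (j : ℕ) •
            (Y j f * α (Matrix.vecCons X (j.removeNth Y))) := by
      simp only [ceBracketSum]
      rw [Fin.sum_univ_succ, Fin.sum_univ_succ (n := n)]
      rw [mul_add, add_right_comm (f * _)]
      congr 1
      · have hI : Finset.Ici (0 : Fin (n + 1)) = Finset.univ := by ext; simp
        rw [hI, Finset.mul_sum, ← Finset.sum_add_distrib]
        refine Finset.sum_congr rfl fun j _ => ?_
        simp only [Fin.castSucc_zero, removeNth_zero_vecCons, Matrix.cons_val_zero,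
          Matrix.cons_val_succ, hlie, Fin.val_zero, zero_add, Fin.val_succ, pow_succ]
        rw [sub_eq_add_neg, ← neg_smul, AlternatingMap.map_vecCons_add,
          AlternatingMap.map_vecCons_smul, AlternatingMap.map_vecCons_smul]
        simp only [zsmul_eq_mul, smul_eq_mul]
        push_cast
        ring
      · rw [Finset.mul_sum]
        refine Finset.sum_congr rfl fun i _ => ?_
        rw [Finset.mul_sum]
        refine Finset.sum_congr rfl fun j hj => ?_
        rw [hinner i j (Finset.mem_Ici.1 hj), mul_smul_comm]
        simp
    simp only [ceDiffFun]
    rw [hb, Fin.sum_univ_succ (n := n + 1), Fin.sum_univ_succ (n := n + 1)]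
    simp only [removeNth_succ_vecCons, removeNth_zero_vecCons,
      Matrix.cons_val_zero, Matrix.cons_val_succ, AlternatingMap.map_vecCons_smul,
      Derivation.smul_apply, Derivation.leibniz, smul_eq_mul, zsmul_eq_mul, Fin.val_succ,
      Fin.val_zero, pow_zero, mul_add, Finset.sum_add_distrib, Finset.mul_sum, pow_succ]
    have h1 : ∀ a b c d e e' : A, e + e' = 0 → a + (b + e) + (c + e') = a + b + c := by
      intro a b c d e e' h
      linear_combination h
    rw [h1 _ _ _ 0]
    · congr 2
      · simp
      · refine Finset.sum_congr rfl fun i _ => ?_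
        ring
    · rw [← Finset.sum_add_distrib]
      refine Finset.sum_eq_zero fun i _ => ?_
      push_cast
      ring

variable [CharZero 𝕜]

/-- Auxiliary: the differential as a `𝕜`-alternating map. -/
def ceDiffAux : ∀ {n : ℕ}, Form 𝕜 A n → (Derivation 𝕜 A A) [⋀^Fin (n + 1)]→ₗ[𝕜] A
  | 0, α => AlternatingMap.alternatizeUncurryFin (anchorAux α)
  | _ + 1, α => AlternatingMap.alternatizeUncurryFin (anchorAux α) -
      (2⁻¹ : 𝕜) • AlternatingMap.alternatizeUncurryFin
        (AlternatingMap.alternatizeUncurryFinLM ∘ₗ bracketAux α)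

theorem ceDiffAux_apply {n : ℕ} (α : Form 𝕜 A n) (X : Fin (n + 1) → Derivation 𝕜 A A) :
    ceDiffAux α X = ceDiffFun α X := by
  cases n with
  | zero =>
    simp [ceDiffAux, ceDiffFun, ceBracketSum, AlternatingMap.alternatizeUncurryFin_apply,
      anchorAux]
  | succ n =>
    have h2 : (2 : 𝕜) ≠ 0 := two_ne_zero
    have key : AlternatingMap.alternatizeUncurryFin
        (AlternatingMap.alternatizeUncurryFinLM ∘ₗ bracketAux α) X
        = (2 : 𝕜) • -ceBracketSum α X := by
      rw [AlternatingMap.alternatizeUncurryFin_alternatizeUncurryFinLM_comp_apply]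
      simp only [ceBracketSum, ← Finset.sum_neg_distrib, Finset.smul_sum]
      refine Finset.sum_congr rfl fun i _ => Finset.sum_congr rfl fun j _ => ?_
      have hs : (α (Matrix.vecCons ⁅X j.succ, X i.castSucc⁆
          (j.removeNth (i.castSucc.removeNth X)))) =
          -(α (Matrix.vecCons ⁅X i.castSucc, X j.succ⁆
          (j.removeNth (i.castSucc.removeNth X)))) := by
        rw [← lie_skew, ← neg_one_smul A, AlternatingMap.map_vecCons_smul]
        simp
      simp only [bracketAux, LinearMap.mk₂_apply, restrictForm_apply,
        AlternatingMap.curryLeft_apply_apply, hs, two_smul, Fin.val_castSucc, Fin.val_succ,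
        ← add_assoc, pow_succ, mul_neg, mul_one, neg_smul, neg_neg, sub_neg_eq_add, smul_add]
    simp only [ceDiffAux, ceDiffFun, AlternatingMap.sub_apply, AlternatingMap.smul_apply, key,
      smul_smul, inv_mul_cancel₀ h2, one_smul, sub_neg_eq_add]
    simp [AlternatingMap.alternatizeUncurryFin_apply, anchorAux]

/-- The Chevalley–Eilenberg differential `CE^n(𝔛(A)) → CE^{n+1}(𝔛(A))`. -/
def ceDiff {n : ℕ} : Form 𝕜 A n →ₗ[𝕜] Form 𝕜 A (n + 1) where
  toFun α :=
    { toFun := ceDiffFun α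
      map_update_add' := by
        intro inst X i Y Z
        obtain rfl : inst = instDecidableEqFin (n + 1) := Subsingleton.elim _ _
        have := (ceDiffAux α).map_update_add X i Y Z
        rwa [ceDiffAux_apply, ceDiffAux_apply, ceDiffAux_apply] at this
      map_update_smul' := by
        intro inst X i f Y
        obtain rfl : inst = instDecidableEqFin (n + 1) := Subsingleton.elim _ _
        have h : ∀ Z, ceDiffFun α (Function.update X i Z) =
            (-1) ^ (i : ℕ) • ceDiffFun α (Matrix.vecCons Z (i.removeNth X)) := by
          intro Z
          have := (ceDiffAux α).map_insertNth i Z (i.removeNth X)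
          rwa [Fin.insertNth_removeNth, ceDiffAux_apply, ceDiffAux_apply] at this
        rw [h, h, ceDiffFun_cons_smul, smul_eq_mul, mul_smul_comm]
      map_eq_zero_of_eq' := by
        intro X i j h hij
        have := (ceDiffAux α).map_eq_zero_of_eq X h hij
        rwa [ceDiffAux_apply] at this }
  map_add' α β := by
    ext X
    cases n <;> simp [ceDiffFun, ceBracketSum, Finset.sum_add_distrib, smul_add]
    ring
  map_smul' c α := by
    ext X
    cases n <;> simp [ceDiffFun, ceBracketSum, Finset.smul_sum]

theorem ceDiff_apply {n : ℕ} (α : Form 𝕜 A n) (X : Fin (n + 1) → Derivation 𝕜 A A) :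
    ceDiff α X = ceDiffFun α X := rfl

/-- The differential `d` of `CE(𝔛(A))`. -/
def dCE : CE 𝕜 A →ₗ[𝕜] CE 𝕜 A :=
  DirectSum.toModule 𝕜 ℕ (CE 𝕜 A) fun n => (CE.of 𝕜 A (n + 1)).restrictScalars 𝕜 ∘ₗ ceDiff

end construction

/-- The contraction `ι_X` of `CE(𝔛(A))`, inserting `X` into the leftmost slot. -/
def contr (X : Derivation 𝕜 A A) : CE 𝕜 A →ₗ[A] CE 𝕜 A :=
  DirectSum.toModule A ℕ (CE 𝕜 A) fun n => match n with
    | 0 => 0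
    | n + 1 => CE.of 𝕜 A n ∘ₗ AlternatingMap.curryLeftLinearMap.flip X

theorem contr_of_succ {n : ℕ} (X : Derivation 𝕜 A A) (α : Form 𝕜 A (n + 1)) :
    contr X (CE.of 𝕜 A (n + 1) α) = CE.of 𝕜 A n (α.curryLeft X) :=
  DirectSum.toModule_lof A (n + 1) α

theorem contr_of_zero (X : Derivation 𝕜 A A) (α : Form 𝕜 A 0) :
    contr X (CE.of 𝕜 A 0 α) = 0 :=
  DirectSum.toModule_lof A 0 α

theorem dCE_of [CharZero 𝕜] {n : ℕ} (α : Form 𝕜 A n) :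
    dCE (CE.of 𝕜 A n α) = CE.of 𝕜 A (n + 1) (ceDiff α) :=
  DirectSum.toModule_lof 𝕜 n α

theorem CE.induction {p : CE 𝕜 A → Prop} (α : CE 𝕜 A) (zero : p 0)
    (of : ∀ n (β : Form 𝕜 A n), p (CE.of 𝕜 A n β)) (add : ∀ β γ, p β → p γ → p (β + γ)) : p α :=
  DirectSum.induction_on α zero of add

theorem contr_add (X Y : Derivation 𝕜 A A) (α : CE 𝕜 A) :
    contr (X + Y) α = contr X α + contr Y α := by
  induction α using CE.induction with
  | zero => simp
  | of n β =>
    cases n with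
    | zero => simp [contr_of_zero]
    | succ n => rw [contr_of_succ, contr_of_succ, contr_of_succ, map_add, map_add]
  | add β γ hβ hγ =>
    rw [map_add, map_add, map_add, hβ, hγ]
    abel

theorem contr_smul (c : 𝕜) (X : Derivation 𝕜 A A) (α : CE 𝕜 A) :
    contr (c • X) α = c • contr X α := by
  induction α using CE.induction with
  | zero => simp
  | of n β =>
    cases n with
    | zero => simp [contr_of_zero]
    | succ n =>
      rw [contr_of_succ, contr_of_succ, LinearMap.map_smul_of_tower, LinearMap.map_smul_of_tower]
  | add β γ hβ hγ => rw [map_add, map_add, hβ, hγ, smul_add]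

/-- The iterated contraction `ι_{X_1} ⋯ ι_{X_n} α`. -/
def iterContr {n : ℕ} (X : Fin n → Derivation 𝕜 A A) (α : CE 𝕜 A) : CE 𝕜 A :=
  (List.ofFn X).foldr (fun Y β => contr Y β) α

/-- The Lie derivative `L_X = [ι_X, d] = ι_X d + d ι_X`. -/
def lieDer [CharZero 𝕜] (X : Derivation 𝕜 A A) (α : CE 𝕜 A) : CE 𝕜 A :=
  contr X (dCE α) + dCE (contr X α)

/-- The homogeneous part of degree `m` of `CE(𝔛(A))` (zero for `m < 0`). -/
def cePart (m : ℤ) : Submodule 𝕜 (CE 𝕜 A) where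
  carrier := {α | ∀ n : ℕ, (n : ℤ) ≠ m → CE.comp 𝕜 A n α = 0}
  zero_mem' := fun _ _ => map_zero _
  add_mem' := fun hα hβ n hn => by
    rw [map_add, hα n hn, hβ n hn, add_zero]
  smul_mem' := fun c α hα n hn => by
    rw [LinearMap.map_smul_of_tower, hα n hn, smul_zero]

end CE

/-! ### Constraint algebras, derivations, Lie–Rinehart algebras and forms -/

section Constraint

variable {𝕜 A : Type*} [Field 𝕜] [CommRing A] [Algebra 𝕜 A]

/-- `C` is a strong constraint algebra with total space `A`: `W` is a (unital) subalgebra, and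
`N ≤ W` is an ideal of `A`. -/
structure IsStrongConstraintAlgebra (C : ConstraintTriple 𝕜 A) : Prop where
  le : C.N ≤ C.W
  one_mem : (1 : A) ∈ C.W
  mul_W : ∀ a ∈ C.W, ∀ b ∈ C.W, a * b ∈ C.W
  mul_N : ∀ (a : A), ∀ b ∈ C.N, a * b ∈ C.N

/-- The constraint space of derivations `𝔛(C)` of a constraint algebra `C`. -/
def derTriple (C : ConstraintTriple 𝕜 A) : ConstraintTriple 𝕜 (Derivation 𝕜 A A) where
  W :=
    { carrier := {X | (∀ a ∈ C.W, X a ∈ C.W) ∧ ∀ a ∈ C.N, X a ∈ C.N}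
      zero_mem' := ⟨fun _ _ => C.W.zero_mem, fun _ _ => C.N.zero_mem⟩
      add_mem' := fun hX hY =>
        ⟨fun a ha => C.W.add_mem (hX.1 a ha) (hY.1 a ha),
          fun a ha => C.N.add_mem (hX.2 a ha) (hY.2 a ha)⟩
      smul_mem' := fun c _ hX =>
        ⟨fun a ha => C.W.smul_mem c (hX.1 a ha), fun a ha => C.N.smul_mem c (hX.2 a ha)⟩ }
  N :=
    { carrier := {X | ∀ a ∈ C.W, X a ∈ C.N}
      zero_mem' := fun _ _ => C.N.zero_mem
      add_mem' := fun hX hY a ha => C.N.add_mem (hX a ha) (hY a ha)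
      smul_mem' := fun c _ hX a ha => C.N.smul_mem c (hX a ha) }

/-- `Y`, with total space the Lie–Rinehart algebra of derivations of `A` (and the identity as
anchor), is a strong constraint Lie–Rinehart algebra over the constraint algebra `C`. -/
structure IsStrongConstraintLieRinehart (C : ConstraintTriple 𝕜 A)
    (Y : ConstraintTriple 𝕜 (Derivation 𝕜 A A)) : Prop where
  strong : IsStrongConstraintAlgebra C
  le : Y.N ≤ Y.W
  lie_W : ∀ X ∈ Y.W, ∀ X' ∈ Y.W, ⁅X, X'⁆ ∈ Y.W
  lie_N : ∀ X ∈ Y.W, ∀ X' ∈ Y.N, ⁅X, X'⁆ ∈ Y.N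
  smul_W : ∀ a ∈ C.W, ∀ X ∈ Y.W, a • X ∈ Y.W
  smul_N_left : ∀ a ∈ C.N, ∀ X : Derivation 𝕜 A A, a • X ∈ Y.N
  smul_N_right : ∀ a : A, ∀ X ∈ Y.N, a • X ∈ Y.N
  anchor_W : Y.W ≤ (derTriple C).W
  anchor_N : Y.N ≤ (derTriple C).N

/-- The triple `CE(Y)` of a constraint Lie–Rinehart algebra `Y` over `C` with total space
`𝔛(A)`: the forms on `W`-tuples with values in `W` that are `N`-valued as soon as one argument lies
in `N`, and the forms on `W`-tuples with values in `N`. -/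
def ceTriple (C : ConstraintTriple 𝕜 A) (Y : ConstraintTriple 𝕜 (Derivation 𝕜 A A)) :
    ConstraintTriple 𝕜 (CE 𝕜 A) where
  W :=
    { carrier := {α | ∀ (n : ℕ) (Z : Fin n → Derivation 𝕜 A A), (∀ i, Z i ∈ Y.W) →
        CE.comp 𝕜 A n α Z ∈ C.W ∧ ∀ i, Z i ∈ Y.N → CE.comp 𝕜 A n α Z ∈ C.N}
      zero_mem' := fun _ _ _ => ⟨C.W.zero_mem, fun _ _ => C.N.zero_mem⟩
      add_mem' := fun hα hβ n Z hZ =>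
        ⟨C.W.add_mem (hα n Z hZ).1 (hβ n Z hZ).1,
          fun i hi => C.N.add_mem ((hα n Z hZ).2 i hi) ((hβ n Z hZ).2 i hi)⟩
      smul_mem' := fun c _ hα n Z hZ =>
        ⟨C.W.smul_mem c (hα n Z hZ).1, fun i hi => C.N.smul_mem c ((hα n Z hZ).2 i hi)⟩ }
  N :=
    { carrier := {α | ∀ (n : ℕ) (Z : Fin n → Derivation 𝕜 A A), (∀ i, Z i ∈ Y.W) → CE.comp 𝕜 A n α Z ∈ C.N}
      zero_mem' := fun _ _ _ => C.N.zero_mem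
      add_mem' := fun hα hβ n Z hZ => C.N.add_mem (hα n Z hZ) (hβ n Z hZ)
      smul_mem' := fun c _ hα n Z hZ => C.N.smul_mem c (hα n Z hZ) }

/-- The triple `V`, with total space `CE(𝔛(A))`, is a constraint Cartan calculus over the
constraint Lie–Rinehart algebra `Y` over `C`: the operations `d`, `ι`, `L` satisfy the commutation
rules of the Cartan calculus and are constraint morphisms.  Here `ι` and `L` are taken on the
generators `C` and `Y` of the exterior algebra, with `ι_a α = a • α` for `a` in `C`; the operators
`L_a = ι_a d - d ι_a` and those of higher multivectors are built from these and `d`. -/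
structure IsConstraintCartanCalculus [CharZero 𝕜] (C : ConstraintTriple 𝕜 A)
    (Y : ConstraintTriple 𝕜 (Derivation 𝕜 A A)) (V : ConstraintTriple 𝕜 (CE 𝕜 A)) : Prop where
  d_d : ∀ α : CE 𝕜 A, dCE (dCE α) = 0
  contr_contr : ∀ (X X' : Derivation 𝕜 A A) (α : CE 𝕜 A),
    contr X (contr X' α) + contr X' (contr X α) = 0
  contr_smul : ∀ (a : A) (X : Derivation 𝕜 A A) (α : CE 𝕜 A), contr (a • X) α = a • contr X α
  d_lieDer : ∀ (X : Derivation 𝕜 A A) (α : CE 𝕜 A), dCE (lieDer X α) = lieDer X (dCE α)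
  lieDer_smul : ∀ (X : Derivation 𝕜 A A) (a : A) (α : CE 𝕜 A),
    lieDer X (a • α) - a • lieDer X α = X a • α
  lieDer_contr : ∀ (X X' : Derivation 𝕜 A A) (α : CE 𝕜 A),
    lieDer X (contr X' α) - contr X' (lieDer X α) = contr ⁅X, X'⁆ α
  lieDer_lieDer : ∀ (X X' : Derivation 𝕜 A A) (α : CE 𝕜 A),
    lieDer X (lieDer X' α) - lieDer X' (lieDer X α) = lieDer ⁅X, X'⁆ α
  le : V.N ≤ V.W
  graded_W : IsGradedSubspace (cePart (𝕜 := 𝕜) (A := A)) V.W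
  graded_N : IsGradedSubspace (cePart (𝕜 := 𝕜) (A := A)) V.N
  d_W : ∀ α ∈ V.W, dCE α ∈ V.W
  d_N : ∀ α ∈ V.N, dCE α ∈ V.N
  smul_W : ∀ a ∈ C.W, ∀ α ∈ V.W, a • α ∈ V.W
  smul_N_left : ∀ a ∈ C.N, ∀ α ∈ V.W, a • α ∈ V.N
  smul_N_right : ∀ a ∈ C.W, ∀ α ∈ V.N, a • α ∈ V.N
  contr_W : ∀ X ∈ Y.W, ∀ α ∈ V.W, contr X α ∈ V.W
  contr_N_left : ∀ X ∈ Y.N, ∀ α ∈ V.W, contr X α ∈ V.N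
  contr_N_right : ∀ X ∈ Y.W, ∀ α ∈ V.N, contr X α ∈ V.N
  lieDer_W : ∀ X ∈ Y.W, ∀ α ∈ V.W, lieDer X α ∈ V.W
  lieDer_N_left : ∀ X ∈ Y.N, ∀ α ∈ V.W, lieDer X α ∈ V.N
  lieDer_N_right : ∀ X ∈ Y.W, ∀ α ∈ V.N, lieDer X α ∈ V.N

/-! ### The construction from an ideal and a set of symmetries -/

/-- The constraint algebra `(A, A, I)`. -/
def baseTriple (𝕜 : Type*) [Field 𝕜] [Algebra 𝕜 A] (I : Ideal A) : ConstraintTriple 𝕜 A where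
  W := ⊤
  N := I.restrictScalars 𝕜

/-- The smallest Lie–Rinehart algebra over `A` inside `𝔛(A)` containing `F` and the derivations
with values in `I`. -/
def symLR (I : Ideal A) (F : Set (Derivation 𝕜 A A)) :
    LieRinehartSubalgebra A (Derivation 𝕜 A A) where
  toSubmodule := sInf {S | ∃ S' : LieRinehartSubalgebra A (Derivation 𝕜 A A),
    S'.toSubmodule = S ∧ F ⊆ S' ∧ ((derTriple (baseTriple 𝕜 I)).N : Set (Derivation 𝕜 A A)) ⊆ S'}
  lie_mem' := by
    intro X Y hX hY
    simp only [AddSubsemigroup.mem_carrier, AddSubmonoid.mem_toSubsemigroup,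
      Submodule.mem_toAddSubmonoid, Submodule.mem_sInf] at hX hY ⊢
    rintro _ ⟨S', rfl, h⟩
    exact S'.lie_mem (hX _ ⟨S', rfl, h⟩) (hY _ ⟨S', rfl, h⟩)

/-- The constraint algebra `A' = (A, {f | 𝓕(f) ⊆ I}, I)`. -/
def redAlg (I : Ideal A) (F : Set (Derivation 𝕜 A A)) : ConstraintTriple 𝕜 A where
  W :=
    { carrier := {f | ∀ X ∈ symLR I F, X f ∈ I}
      zero_mem' := fun X _ => by simp
      add_mem' := fun hf hg X hX => by
        rw [map_add]
        exact I.add_mem (hf X hX) (hg X hX)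
      smul_mem' := fun c f hf X hX => by
        rw [Derivation.map_smul]
        exact (I.restrictScalars 𝕜).smul_mem c (hf X hX) }
  N := I.restrictScalars 𝕜

/-- The constraint Lie–Rinehart algebra `𝔜 = (𝔛(A), 𝓝(𝓕), 𝓕)`, where `𝓝(𝓕)` is the normalizer
of `𝓕` in the Lie algebra of derivations preserving `I`. -/
def redLR (I : Ideal A) (F : Set (Derivation 𝕜 A A)) :
    ConstraintTriple 𝕜 (Derivation 𝕜 A A) where
  W :=
    { carrier := {X | X ∈ (derTriple (baseTriple 𝕜 I)).W ∧ ∀ Y ∈ symLR I F, ⁅Y, X⁆ ∈ symLR I F}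
      zero_mem' := ⟨Submodule.zero_mem _, fun Y _ => by
        rw [lie_zero]
        exact (symLR I F).zero_mem⟩
      add_mem' := fun hX hX' => ⟨Submodule.add_mem _ hX.1 hX'.1, fun Y hY => by
        rw [lie_add]
        exact (symLR I F).add_mem (hX.2 Y hY) (hX'.2 Y hY)⟩
      smul_mem' := fun c X hX => ⟨Submodule.smul_mem _ c hX.1, fun Y hY => by
        rw [lie_smul]
        exact ((symLR I F).toSubmodule.restrictScalars 𝕜).smul_mem c (hX.2 Y hY)⟩ }
  N := (symLR I F).toSubmodule.restrictScalars 𝕜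

/-- `B = CE(𝔛(A, A, I))`. -/
def formTriple (𝕜 : Type*) [Field 𝕜] [Algebra 𝕜 A] (I : Ideal A) :
    ConstraintTriple 𝕜 (CE 𝕜 A) :=
  ceTriple (baseTriple 𝕜 I) (derTriple (baseTriple 𝕜 I))

/-- The basic forms `B' = (B, {α ∈ B_W | ι_X α, L_X α ∈ B_N for X ∈ 𝓕}, B_N)`. -/
def basicTriple [CharZero 𝕜] (I : Ideal A) (F : Set (Derivation 𝕜 A A)) :
    ConstraintTriple 𝕜 (CE 𝕜 A) where
  W :=
    { carrier := {α | α ∈ (formTriple 𝕜 I).W ∧ ∀ X ∈ (redLR I F).N,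
        contr X α ∈ (formTriple 𝕜 I).N ∧ lieDer X α ∈ (formTriple 𝕜 I).N}
      zero_mem' := ⟨Submodule.zero_mem _, fun X _ => by simp [lieDer]⟩
      add_mem' := fun {α β} hα hβ => ⟨Submodule.add_mem _ hα.1 hβ.1, fun X hX => by
        have h : lieDer X (α + β) = lieDer X α + lieDer X β := by
          simp only [lieDer, map_add]
          abel
        rw [map_add, h]
        exact ⟨Submodule.add_mem _ (hα.2 X hX).1 (hβ.2 X hX).1,
          Submodule.add_mem _ (hα.2 X hX).2 (hβ.2 X hX).2⟩⟩
      smul_mem' := fun c α hα => ⟨Submodule.smul_mem _ c hα.1, fun X hX => by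
        have h : ∀ β : CE 𝕜 A, contr X (c • β) = c • contr X β :=
          fun β => LinearMap.map_smul_of_tower _ c β
        have h' : lieDer X (c • α) = c • lieDer X α := by
          simp only [lieDer, map_smul, h, smul_add]
        rw [h, h']
        exact ⟨Submodule.smul_mem _ c (hα.2 X hX).1, Submodule.smul_mem _ c (hα.2 X hX).2⟩⟩ }
  N := (formTriple 𝕜 I).N

end Constraint

/-! ### Hamiltonian pairs and the observables -/

section Observables

variable {𝕜 A : Type*} [Field 𝕜] [CharZero 𝕜] [CommRing A] [Algebra 𝕜 A]

/-- `Ham^i(CE(𝔛(A)), ω)` for `ω` of degree `k + 1`, as a subspace of `CE(𝔛(A)) × 𝔛(A)`: the pairs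
`(α, X)` with `α` of degree `k - 1` and `ι_X ω = -dα` for `i = 0`, and the forms of degree
`k - 1 + i` (paired with `0`) for `i < 0`. -/
def hamPart (k : ℕ) (ω : CE 𝕜 A) (i : ℤ) : Submodule 𝕜 (CE 𝕜 A × Derivation 𝕜 A A) :=
  if i = 0 then
    { carrier := {x | x.1 ∈ cePart ((k : ℤ) - 1) ∧ contr x.2 ω = -dCE x.1}
      zero_mem' := ⟨Submodule.zero_mem _, by
        rw [Prod.snd_zero, Prod.fst_zero, ← zero_smul 𝕜 (0 : Derivation 𝕜 A A), contr_smul,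
          zero_smul, map_zero, neg_zero]⟩
      add_mem' := fun {x y} hx hy => ⟨Submodule.add_mem _ hx.1 hy.1, by
        rw [Prod.snd_add, Prod.fst_add, contr_add, hx.2, hy.2, map_add, neg_add]⟩
      smul_mem' := fun c x hx => ⟨Submodule.smul_mem _ c hx.1, by
        rw [Prod.smul_snd, Prod.smul_fst, contr_smul, hx.2, map_smul, smul_neg]⟩ }
  else if i < 0 then (cePart ((k : ℤ) - 1 + i)).prod ⊥
  else ⊥

/-- `Ham(CE(𝔛(A)), ω) = ⨁_{i ≤ 0} Ham^i(CE(𝔛(A)), ω)`. -/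
def ham (k : ℕ) (ω : CE 𝕜 A) : Submodule 𝕜 (CE 𝕜 A × Derivation 𝕜 A A) :=
  ⨆ i, hamPart k ω i

/-- The grading of `Ham(CE(𝔛(A)), ω)`. -/
def hamGrading (k : ℕ) (ω : CE 𝕜 A) (i : ℤ) : Submodule 𝕜 (ham k ω) :=
  (hamPart k ω i).comap (ham k ω).subtype

/-- The constraint graded vector space `Ham(V, ω)`, for a triple `V` with total space `CE(𝔛(A))`
and a triple `Y` with total space `𝔛(A)`. -/
def hamTriple (k : ℕ) (ω : CE 𝕜 A) (V : ConstraintTriple 𝕜 (CE 𝕜 A))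
    (Y : ConstraintTriple 𝕜 (Derivation 𝕜 A A)) : ConstraintTriple 𝕜 (ham k ω) where
  W := (V.W.prod Y.W).comap (ham k ω).subtype
  N := (V.N.prod Y.N).comap (ham k ω).subtype

/-- The multibrackets `l` on `Ham(CE(𝔛(A)), ω)` are those of the `L∞`-algebra of observables. -/
structure IsObservablesBracket (k : ℕ) (ω : CE 𝕜 A)
    (l : ∀ n : ℕ, MultilinearMap 𝕜 (fun _ : Fin n => ham k ω) (ham k ω)) : Prop where
  unary_neg : ∀ i < 0, ∀ x ∈ hamGrading k ω i,
    (l 1 ![x] : CE 𝕜 A × Derivation 𝕜 A A) = (dCE x.1.1, 0)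
  unary_zero : ∀ x ∈ hamGrading k ω 0, l 1 ![x] = 0
  binary : ∀ x ∈ hamGrading k ω 0, ∀ y ∈ hamGrading k ω 0,
    (l 2 ![x, y] : CE 𝕜 A × Derivation 𝕜 A A) =
      (-contr x.1.2 (contr y.1.2 ω), ⁅x.1.2, y.1.2⁆)
  higher : ∀ n ≥ 3, ∀ x : Fin n → ham k ω, (∀ a, x a ∈ hamGrading k ω 0) →
    (l n x : CE 𝕜 A × Derivation 𝕜 A A) =
      ((-1 : ℤ) ^ (n + 1) • iterContr (fun a => (x a).1.2) ω, 0)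
  vanish : ∀ n ≥ 2, ∀ x : Fin n → ham k ω, ∀ a, ∀ i ≠ 0, x a ∈ hamGrading k ω i → l n x = 0

end Observables

end ConstraintReduction

open ConstraintReduction

namespace ConstraintReduction

/-! ### Cartan calculus on forms over the derivations of `A` -/

section CartanCalculus

variable {𝕜 A : Type*} [Field 𝕜] [CommRing A] [Algebra 𝕜 A]

/-! The whole theorem rests on Cartan's rules. Expanding d in its first slot yields the explicit
formula `comp_lieDer_apply` for L_X, and with it [L_X, ι_Y] = ι_[X,Y]. The identities [L_X, L_Y] =
L_[X,Y], [d, L_X] = 0 and d² = 0 then follow without evaluating forms of positive degree: in each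
case the difference of the two sides is an operator without degree-zero part that commutes up to
sign with every ι_Z, and such an operator vanishes (`operator_eq_zero`).

For the reduction, B_N is stable under d and under ι_X, L_X for X preserving I, and α lies in B_W
exactly when ι_X α ∈ B_N for all X in 𝔛₀ (`mem_form_W`). Stability of the basic forms is then
formal: ι_X d = L_X - d ι_X handles d, and [𝓕, X] ⊆ 𝓕 handles ι_X for X in the normalizer.
Invariance of ω passes from F to 𝓕 because, for closed ω in B_W, the X preserving I with ι_X ω ∈ B_N
form a Lie–Rinehart subalgebra containing F and 𝔛₀.

On Ham, every l_j with j ≥ 2 depends only on the vector fields, and only l_2 has a vector field in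
its output. Hence in the n-th Jacobi identity, n ≥ 3, with arguments of degree 0, only l_{n-1} ∘ l_2
and l_1 ∘ l_n survive. Their form components cancel by the formula `dCE_iterContr` for d ι_{X_1} ⋯
ι_{X_n} ω; the vector field components are the Jacobi identity of derivations. The brackets respect
W and N because the innermost contraction of ω is -dα for an α of the required type, and the further
contractions are constraint maps. The reduced algebra is obtained by descending multilinear maps to
W / N. -/

theorem CE.ext_comp {α β : CE 𝕜 A} (h : ∀ n, CE.comp 𝕜 A n α = CE.comp 𝕜 A n β) : α = β :=
  DFinsupp.ext h

theorem CE.comp_of_same (n : ℕ) (β : Form 𝕜 A n) : CE.comp 𝕜 A n (CE.of 𝕜 A n β) = β :=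
  DirectSum.component.lof_self A n β

theorem CE.comp_of_ne {m n : ℕ} (h : m ≠ n) (β : Form 𝕜 A m) :
    CE.comp 𝕜 A n (CE.of 𝕜 A m β) = 0 :=
  (DirectSum.component.of (R := A) n m β).trans (dif_neg h)

theorem comp_contr (n : ℕ) (X : Derivation 𝕜 A A) (α : CE 𝕜 A) :
    CE.comp 𝕜 A n (contr X α) = (CE.comp 𝕜 A (n + 1) α).curryLeft X := by
  induction α using CE.induction with
  | zero => simp
  | of m β =>
    cases m with
    | zero => rw [contr_of_zero, CE.comp_of_ne (by omega)]; simp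
    | succ m =>
      rw [contr_of_succ]
      by_cases h : m = n
      · subst h
        rw [CE.comp_of_same, CE.comp_of_same]
      · rw [CE.comp_of_ne h, CE.comp_of_ne (by omega)]
        simp
  | add β γ hβ hγ => rw [map_add, map_add, hβ, hγ, map_add]; rfl

theorem comp_contr_apply (n : ℕ) (X : Derivation 𝕜 A A) (α : CE 𝕜 A)
    (Z : Fin n → Derivation 𝕜 A A) :
    CE.comp 𝕜 A n (contr X α) Z = CE.comp 𝕜 A (n + 1) α (Matrix.vecCons X Z) := by
  rw [comp_contr]
  rfl

theorem contr_zero_left (α : CE 𝕜 A) : contr (0 : Derivation 𝕜 A A) α = 0 := by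
  rw [← zero_smul 𝕜 (0 : Derivation 𝕜 A A), contr_smul, zero_smul]

theorem contr_smul_left (a : A) (X : Derivation 𝕜 A A) (α : CE 𝕜 A) :
    contr (a • X) α = a • contr X α := by
  refine CE.ext_comp fun n => ?_
  rw [map_smul, comp_contr, comp_contr, map_smul]

theorem contr_contr_self (X : Derivation 𝕜 A A) (α : CE 𝕜 A) : contr X (contr X α) = 0 := by
  refine CE.ext_comp fun n => AlternatingMap.ext fun Z => ?_
  rw [comp_contr_apply, comp_contr_apply, map_zero]
  exact AlternatingMap.map_eq_zero_of_eq _ _ (i := 0) (j := 1) rfl (by simp)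

theorem contr_contr_add (X Y : Derivation 𝕜 A A) (α : CE 𝕜 A) :
    contr X (contr Y α) + contr Y (contr X α) = 0 := by
  have h := contr_contr_self (X + Y) α
  rw [contr_add, contr_add, map_add, map_add, contr_contr_self, contr_contr_self] at h
  simpa using h

theorem contr_contr_swap (X Y : Derivation 𝕜 A A) (α : CE 𝕜 A) :
    contr X (contr Y α) = -contr Y (contr X α) :=
  eq_neg_of_add_eq_zero_left (contr_contr_add X Y α)

/-- An operator vanishes if its values have no part of degree zero and its contractions are again
values of the operator. -/
theorem operator_eq_zero (D : CE 𝕜 A → CE 𝕜 A) (h0 : ∀ α, CE.comp 𝕜 A 0 (D α) = 0)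
    (hD : ∀ (Z : Derivation 𝕜 A A) (α : CE 𝕜 A), ∃ β, contr Z (D α) = D β) (α : CE 𝕜 A) :
    D α = 0 := by
  -- Induction on the form degree, for all α at once, since contraction replaces α by another
  -- element β.
  have key : ∀ n α, CE.comp 𝕜 A n (D α) = 0 := by
    intro n
    induction n with
    | zero => exact h0
    | succ n ih =>
      intro α
      refine AlternatingMap.ext fun Z => ?_
      obtain ⟨β, hβ⟩ := hD (Z 0) α
      have h := comp_contr_apply n (Z 0) (D α) (Matrix.vecTail Z)
      rw [hβ, ih] at h
      rw [show Z = Matrix.vecCons (Z 0) (Matrix.vecTail Z) from (Matrix.cons_head_tail Z).symm, ← h]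
      rfl
  exact CE.ext_comp fun n => by rw [key, map_zero]

/-- The pairs involving the first slot give the explicit sum. In all other pairs the bracket is
moved past X, which costs a sign and leaves the bracket sum of ι_X α. -/
theorem ceBracketSum_vecCons {n : ℕ} (α : Form 𝕜 A (n + 1)) (X : Derivation 𝕜 A A)
    (Z : Fin (n + 1) → Derivation 𝕜 A A) :
    ceBracketSum α (Matrix.vecCons X Z) =
      ∑ j : Fin (n + 1), (-1 : ℤ) ^ ((j : ℕ) + 1) • α (Matrix.vecCons ⁅X, Z j⁆ (j.removeNth Z)) -
        ceBracketSum (α.curryLeft X) Z := by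
  have hswap : ∀ {m : ℕ} (β : Form 𝕜 A (m + 2)) (U V : Derivation 𝕜 A A)
      (W : Fin m → Derivation 𝕜 A A),
      β (Matrix.vecCons U (Matrix.vecCons V W)) = -β (Matrix.vecCons V (Matrix.vecCons U W)) := by
    intro m β U V W
    have h := congrArg (fun γ => CE.comp 𝕜 A m γ W) (contr_contr_swap V U (CE.of 𝕜 A _ β))
    simpa [comp_contr_apply, CE.comp_of_same] using h
  rw [ceBracketSum, Fin.sum_univ_succ, sub_eq_add_neg]
  congr 1
  · have hI : Finset.Ici (0 : Fin (n + 1)) = Finset.univ := by ext; simp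
    rw [hI]
    refine Finset.sum_congr rfl fun j _ => ?_
    simp
  · cases n with
    | zero => simp [ceBracketSum]
    | succ n =>
      rw [ceBracketSum, ← Finset.sum_neg_distrib]
      refine Finset.sum_congr rfl fun i _ => ?_
      rw [Fin.sum_Ici_succ, ← Finset.sum_neg_distrib]
      refine Finset.sum_congr rfl fun j _ => ?_
      simp only [← Fin.succ_castSucc, removeNth_succ_vecCons, Matrix.cons_val_succ,
        AlternatingMap.curryLeft_apply_apply, hswap α X, smul_neg, neg_neg, Fin.val_succ]
      congr 1
      ring

theorem form_update {n : ℕ} (α : Form 𝕜 A (n + 1)) (i : Fin (n + 1))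
    (Z : Fin (n + 1) → Derivation 𝕜 A A) (X : Derivation 𝕜 A A) :
    α (Function.update Z i X) = (-1 : ℤ) ^ (i : ℕ) • α (Matrix.vecCons X (i.removeNth Z)) := by
  rw [← α.map_insertNth, Fin.insertNth_removeNth]

/-- Cartan's formula for the Lie derivative of a form of positive degree. -/
theorem ceDiffFun_vecCons_add {n : ℕ} (α : Form 𝕜 A (n + 1)) (X : Derivation 𝕜 A A)
    (Z : Fin (n + 1) → Derivation 𝕜 A A) :
    ceDiffFun α (Matrix.vecCons X Z) + ceDiffFun (α.curryLeft X) Z =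
      X (α Z) - ∑ i, α (Function.update Z i ⁅X, Z i⁆) := by
  have h1 : ∑ i, α (Function.update Z i ⁅X, Z i⁆) =
      -∑ j : Fin (n + 1), (-1 : ℤ) ^ ((j : ℕ) + 1) •
        α (Matrix.vecCons ⁅X, Z j⁆ (j.removeNth Z)) := by
    rw [← Finset.sum_neg_distrib]
    refine Finset.sum_congr rfl fun i _ => ?_
    rw [form_update, pow_succ, mul_neg_one, neg_smul, neg_neg]
  have h2 : ∑ i : Fin (n + 1), (-1 : ℤ) ^ (i.succ : ℕ) •
        (Matrix.vecCons X Z) i.succ (α (i.succ.removeNth (Matrix.vecCons X Z))) =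
      -∑ i : Fin (n + 1), (-1 : ℤ) ^ (i : ℕ) • Z i (α.curryLeft X (i.removeNth Z)) := by
    rw [← Finset.sum_neg_distrib]
    refine Finset.sum_congr rfl fun i _ => ?_
    rw [removeNth_succ_vecCons, Matrix.cons_val_succ, Fin.val_succ, pow_succ, mul_neg_one,
      neg_smul]
    rfl
  -- The bracket sums of ι_X α cancel, and so do the anchor terms of all slots except the one
  -- holding X.
  rw [ceDiffFun, ceDiffFun, ceBracketSum_vecCons, h1, Fin.sum_univ_succ, h2,
    removeNth_zero_vecCons, Matrix.cons_val_zero, Fin.val_zero, pow_zero, one_smul]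
  abel

section Differential

variable [CharZero 𝕜]

theorem comp_dCE_succ (n : ℕ) (α : CE 𝕜 A) :
    CE.comp 𝕜 A (n + 1) (dCE α) = ceDiff (CE.comp 𝕜 A n α) := by
  induction α using CE.induction with
  | zero => simp
  | of m β =>
    rw [dCE_of]
    by_cases h : m = n
    · subst h
      rw [CE.comp_of_same, CE.comp_of_same]
    · rw [CE.comp_of_ne h, CE.comp_of_ne (by omega), map_zero]
  | add β γ hβ hγ => rw [map_add, map_add, hβ, hγ, map_add, map_add]

theorem comp_dCE_zero (α : CE 𝕜 A) : CE.comp 𝕜 A 0 (dCE α) = 0 := by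
  induction α using CE.induction with
  | zero => simp
  | of m β => rw [dCE_of, CE.comp_of_ne (by omega)]
  | add β γ hβ hγ => rw [map_add, map_add, hβ, hγ, add_zero]

/-- Cartan's formula in every degree; for n = 0 the sum is empty and L_X acts on functions as X. -/
theorem comp_lieDer_apply (n : ℕ) (X : Derivation 𝕜 A A) (α : CE 𝕜 A)
    (Z : Fin n → Derivation 𝕜 A A) :
    CE.comp 𝕜 A n (lieDer X α) Z =
      X (CE.comp 𝕜 A n α Z) - ∑ i, CE.comp 𝕜 A n α (Function.update Z i ⁅X, Z i⁆) := by
  rw [lieDer, map_add, AlternatingMap.add_apply, comp_contr_apply, comp_dCE_succ, ceDiff_apply]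
  cases n with
  | zero =>
    rw [comp_dCE_zero]
    simp [ceDiffFun, ceBracketSum]
  | succ n =>
    rw [comp_dCE_succ, ceDiff_apply, comp_contr, ceDiffFun_vecCons_add]

/-- In the explicit formula for L_X α at (Y, Z), slot 0 contributes α([X, Y], Z); all other terms
are those of L_X ι_Y α at Z. -/
theorem lieDer_contr_sub (X Y : Derivation 𝕜 A A) (α : CE 𝕜 A) :
    lieDer X (contr Y α) - contr Y (lieDer X α) = contr ⁅X, Y⁆ α := by
  refine CE.ext_comp fun n => AlternatingMap.ext fun Z => ?_
  rw [map_sub, AlternatingMap.sub_apply, comp_lieDer_apply, comp_contr_apply, comp_contr_apply,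
    comp_contr_apply, comp_lieDer_apply, Fin.sum_univ_succ]
  have h : ∀ i : Fin n, Function.update (Matrix.vecCons Y Z) i.succ
      ⁅X, (Matrix.vecCons Y Z) i.succ⁆ = Matrix.vecCons Y (Function.update Z i ⁅X, Z i⁆) := by
    intro i
    rw [Matrix.cons_val_succ]
    exact (Fin.cons_update (α := fun _ => Derivation 𝕜 A A) Y Z i _).symm
  have h0 : Function.update (Matrix.vecCons Y Z) 0 ⁅X, (Matrix.vecCons Y Z) 0⁆ =
      Matrix.vecCons ⁅X, Y⁆ Z := by
    rw [Matrix.cons_val_zero]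
    exact Fin.update_cons_zero (α := fun _ => Derivation 𝕜 A A) Y Z _
  simp only [h, h0, comp_contr_apply]
  abel

theorem lieDer_contr (X Y : Derivation 𝕜 A A) (α : CE 𝕜 A) :
    lieDer X (contr Y α) = contr ⁅X, Y⁆ α + contr Y (lieDer X α) :=
  eq_add_of_sub_eq (lieDer_contr_sub X Y α)

theorem lieDer_add (X : Derivation 𝕜 A A) (α β : CE 𝕜 A) :
    lieDer X (α + β) = lieDer X α + lieDer X β := by
  simp only [lieDer, map_add]
  abel

theorem lieDer_neg (X : Derivation 𝕜 A A) (α : CE 𝕜 A) : lieDer X (-α) = -lieDer X α := by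
  simp only [lieDer, map_neg]
  abel

theorem lieDer_sub (X : Derivation 𝕜 A A) (α β : CE 𝕜 A) :
    lieDer X (α - β) = lieDer X α - lieDer X β := by
  rw [sub_eq_add_neg, lieDer_add, lieDer_neg, sub_eq_add_neg]

theorem lieDer_smul_sub (X : Derivation 𝕜 A A) (a : A) (α : CE 𝕜 A) :
    lieDer X (a • α) - a • lieDer X α = X a • α := by
  refine CE.ext_comp fun n => AlternatingMap.ext fun Z => ?_
  simp only [map_sub, map_smul, AlternatingMap.sub_apply, AlternatingMap.smul_apply,
    comp_lieDer_apply, smul_eq_mul, Derivation.leibniz, ← Finset.mul_sum]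
  ring

theorem lieDer_lieDer_sub (X Y : Derivation 𝕜 A A) (α : CE 𝕜 A) :
    lieDer X (lieDer Y α) - lieDer Y (lieDer X α) = lieDer ⁅X, Y⁆ α := by
  refine sub_eq_zero.1 (operator_eq_zero
    (fun α => lieDer X (lieDer Y α) - lieDer Y (lieDer X α) - lieDer ⁅X, Y⁆ α) ?_ ?_ α)
  · intro α
    refine AlternatingMap.ext fun Z => ?_
    simp [comp_lieDer_apply, Derivation.commutator_apply]
  · intro Z α
    -- The defect commutes with ι_Z, by the Jacobi identity for X, Y, Z.
    refine ⟨contr Z α, ?_⟩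
    simp only [map_sub, lieDer_contr, lieDer_add]
    have h : contr ⁅X, ⁅Y, Z⁆⁆ α = contr ⁅⁅X, Y⁆, Z⁆ α + contr ⁅Y, ⁅X, Z⁆⁆ α := by
      rw [← contr_add, ← leibniz_lie]
    rw [h]
    abel

theorem contr_dCE (X : Derivation 𝕜 A A) (α : CE 𝕜 A) :
    contr X (dCE α) = lieDer X α - dCE (contr X α) := by
  rw [lieDer, add_sub_cancel_right]

theorem dCE_contr (X : Derivation 𝕜 A A) (α : CE 𝕜 A) :
    dCE (contr X α) = lieDer X α - contr X (dCE α) := by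
  rw [lieDer, add_sub_cancel_left]

theorem dCE_lieDer (X : Derivation 𝕜 A A) (α : CE 𝕜 A) :
    dCE (lieDer X α) = lieDer X (dCE α) := by
  refine sub_eq_zero.1 (operator_eq_zero (fun α => dCE (lieDer X α) - lieDer X (dCE α)) ?_ ?_ α)
  · intro α
    refine AlternatingMap.ext fun Z => ?_
    simp [comp_lieDer_apply, comp_dCE_zero]
  · intro Z α
    -- The sign appears because [d, L_X] is an odd operator: it anticommutes with ι_Z.
    refine ⟨-contr Z α, ?_⟩
    have h1 : contr Z (lieDer X (dCE α)) =
        lieDer X (contr Z (dCE α)) - contr ⁅X, Z⁆ (dCE α) := by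
      rw [lieDer_contr]
      abel
    have h2 : contr Z (lieDer X α) = lieDer X (contr Z α) - contr ⁅X, Z⁆ α := by
      rw [lieDer_contr]
      abel
    have h3 := lieDer_lieDer_sub X Z α
    simp only [map_sub, map_neg, lieDer_neg, h1, contr_dCE, h2, lieDer_sub, ← h3]
    abel

theorem dCE_dCE (α : CE 𝕜 A) : dCE (dCE α) = 0 := by
  refine operator_eq_zero (fun α => dCE (dCE α)) ?_ ?_ α
  · intro α
    exact comp_dCE_zero _
  · intro Z α
    -- In ι_Z d d = L_Z d - d L_Z + d d ι_Z the first two terms cancel.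
    refine ⟨contr Z α, ?_⟩
    simp only [contr_dCE, map_sub, dCE_lieDer]
    abel

end Differential

end CartanCalculus

/-! ### Homogeneous components of forms -/

section Grading

variable {𝕜 A : Type*} [Field 𝕜] [CommRing A] [Algebra 𝕜 A]

/-- The projection of `CE(𝔛(A))` onto its part of degree `n`. -/
def ceProj (n : ℕ) : CE 𝕜 A →ₗ[A] CE 𝕜 A := CE.of 𝕜 A n ∘ₗ CE.comp 𝕜 A n

theorem comp_ceProj_same (n : ℕ) (α : CE 𝕜 A) :
    CE.comp 𝕜 A n (ceProj n α) = CE.comp 𝕜 A n α :=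
  CE.comp_of_same n _

theorem comp_ceProj_ne {m n : ℕ} (h : n ≠ m) (α : CE 𝕜 A) : CE.comp 𝕜 A m (ceProj n α) = 0 :=
  CE.comp_of_ne h _

theorem ceProj_mem_cePart (n : ℕ) (α : CE 𝕜 A) : ceProj n α ∈ cePart (n : ℤ) :=
  fun _ hm => comp_ceProj_ne (fun h => hm (by rw [h])) α

theorem ceProj_of_mem {n : ℕ} {α : CE 𝕜 A} (h : α ∈ cePart (n : ℤ)) : ceProj n α = α := by
  refine CE.ext_comp fun m => ?_
  by_cases hm : n = m
  · subst hm
    exact comp_ceProj_same n α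
  · rw [comp_ceProj_ne hm, h m (by omega)]

theorem ceProj_of_mem_ne {n : ℕ} {m : ℤ} {α : CE 𝕜 A} (h : α ∈ cePart m) (hm : (n : ℤ) ≠ m) :
    ceProj n α = 0 := by
  change CE.of 𝕜 A n (CE.comp 𝕜 A n α) = 0
  rw [h n hm, map_zero]

theorem CE.exists_comp_eq_zero (α : CE 𝕜 A) : ∃ N, ∀ n ≥ N, CE.comp 𝕜 A n α = 0 := by
  induction α using CE.induction with
  | zero => exact ⟨0, fun _ _ => map_zero _⟩
  | of m β => exact ⟨m + 1, fun n hn => CE.comp_of_ne (by omega) β⟩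
  | add β γ hβ hγ =>
    obtain ⟨N, hN⟩ := hβ
    obtain ⟨M, hM⟩ := hγ
    exact ⟨max N M, fun n hn => by
      rw [map_add, hN n (le_of_max_le_left hn), hM n (le_of_max_le_right hn), add_zero]⟩

theorem CE.eq_sum_ceProj {α : CE 𝕜 A} {N : ℕ} (h : ∀ n ≥ N, CE.comp 𝕜 A n α = 0) :
    α = ∑ n ∈ Finset.range N, ceProj n α := by
  refine CE.ext_comp fun m => ?_
  rw [map_sum]
  by_cases hm : m < N
  · rw [Finset.sum_eq_single_of_mem m (Finset.mem_range.2 hm)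
      fun n _ hn => comp_ceProj_ne hn α, comp_ceProj_same]
  · rw [h m (by omega), Finset.sum_eq_zero]
    intro n hn
    exact comp_ceProj_ne (by have := Finset.mem_range.1 hn; omega) α

theorem isGradedSubspace_of_ceProj_mem {V : Submodule 𝕜 (CE 𝕜 A)}
    (h : ∀ α ∈ V, ∀ n, ceProj n α ∈ V) : IsGradedSubspace (cePart (𝕜 := 𝕜) (A := A)) V := by
  refine le_antisymm (fun α hα => ?_) (iSup_le fun i => inf_le_left)
  obtain ⟨N, hN⟩ := CE.exists_comp_eq_zero α
  rw [CE.eq_sum_ceProj hN]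
  exact Submodule.sum_mem _ fun n _ =>
    Submodule.mem_iSup_of_mem (n : ℤ) ⟨h α hα n, ceProj_mem_cePart n α⟩

theorem contr_ceProj_succ (n : ℕ) (X : Derivation 𝕜 A A) (α : CE 𝕜 A) :
    contr X (ceProj (n + 1) α) = ceProj n (contr X α) := by
  change contr X (CE.of 𝕜 A (n + 1) _) = CE.of 𝕜 A n _
  rw [contr_of_succ, comp_contr]

theorem contr_ceProj_zero (X : Derivation 𝕜 A A) (α : CE 𝕜 A) : contr X (ceProj 0 α) = 0 :=
  contr_of_zero X _

theorem contr_mem_cePart (X : Derivation 𝕜 A A) {α : CE 𝕜 A} {m : ℤ} (h : α ∈ cePart m) :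
    contr X α ∈ cePart (m - 1) := by
  intro n hn
  rw [comp_contr, h (n + 1) (by push_cast; omega)]
  rfl

variable [CharZero 𝕜]

theorem dCE_mem_cePart {α : CE 𝕜 A} {m : ℤ} (h : α ∈ cePart m) : dCE α ∈ cePart (m + 1) := by
  intro n hn
  cases n with
  | zero => exact comp_dCE_zero α
  | succ n => rw [comp_dCE_succ, h n (by push_cast at hn; omega), map_zero]

theorem dCE_ceProj (n : ℕ) (α : CE 𝕜 A) : dCE (ceProj n α) = ceProj (n + 1) (dCE α) := by
  change dCE (CE.of 𝕜 A n _) = CE.of 𝕜 A (n + 1) _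
  rw [dCE_of, comp_dCE_succ]

theorem lieDer_ceProj (n : ℕ) (X : Derivation 𝕜 A A) (α : CE 𝕜 A) :
    lieDer X (ceProj n α) = ceProj n (lieDer X α) := by
  rw [lieDer, lieDer, dCE_ceProj, contr_ceProj_succ, map_add]
  cases n with
  | zero =>
    rw [contr_ceProj_zero, map_zero]
    congr 1
    change 0 = CE.of 𝕜 A 0 _
    rw [comp_dCE_zero, map_zero]
  | succ n => rw [contr_ceProj_succ, dCE_ceProj]

end Grading

/-! ### The reduced constraint algebra, its derivations and the basic forms -/

section Reduction

variable {𝕜 A : Type*} [Field 𝕜] [CommRing A] [Algebra 𝕜 A] {I : Ideal A}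
  {F : Set (Derivation 𝕜 A A)}

theorem mem_der_W {X : Derivation 𝕜 A A} :
    X ∈ (derTriple (baseTriple 𝕜 I)).W ↔ ∀ a ∈ I, X a ∈ I :=
  ⟨fun h => h.2, fun h => ⟨fun _ _ => trivial, h⟩⟩

theorem mem_der_N {X : Derivation 𝕜 A A} :
    X ∈ (derTriple (baseTriple 𝕜 I)).N ↔ ∀ a, X a ∈ I :=
  ⟨fun h a => h a trivial, fun h a _ => h a⟩

theorem der_N_le_W : (derTriple (baseTriple 𝕜 I)).N ≤ (derTriple (baseTriple 𝕜 I)).W :=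
  fun _ hX => mem_der_W.2 fun a _ => mem_der_N.1 hX a

theorem lie_mem_der_W {X Y : Derivation 𝕜 A A} (hX : X ∈ (derTriple (baseTriple 𝕜 I)).W)
    (hY : Y ∈ (derTriple (baseTriple 𝕜 I)).W) : ⁅X, Y⁆ ∈ (derTriple (baseTriple 𝕜 I)).W := by
  rw [mem_der_W] at *
  intro a ha
  rw [Derivation.commutator_apply]
  exact I.sub_mem (hX _ (hY a ha)) (hY _ (hX a ha))

theorem lie_mem_der_N {X Y : Derivation 𝕜 A A} (hX : X ∈ (derTriple (baseTriple 𝕜 I)).N)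
    (hY : Y ∈ (derTriple (baseTriple 𝕜 I)).W) : ⁅X, Y⁆ ∈ (derTriple (baseTriple 𝕜 I)).N := by
  rw [mem_der_N] at *
  rw [mem_der_W] at hY
  intro a
  rw [Derivation.commutator_apply]
  exact I.sub_mem (hX _) (hY _ (hX a))

theorem symLR_le {S : LieRinehartSubalgebra A (Derivation 𝕜 A A)} (hF : F ⊆ S)
    (hS : ((derTriple (baseTriple 𝕜 I)).N : Set (Derivation 𝕜 A A)) ⊆ S)
    {X : Derivation 𝕜 A A} (hX : X ∈ symLR I F) : X ∈ S :=
  Submodule.mem_sInf.1 hX _ ⟨S, rfl, hF, hS⟩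

theorem mem_symLR_of_der_N {X : Derivation 𝕜 A A} (hX : X ∈ (derTriple (baseTriple 𝕜 I)).N) :
    X ∈ symLR I F :=
  Submodule.mem_sInf.2 <| by
    rintro _ ⟨S, rfl, _, hS⟩
    exact hS hX

theorem smul_mem_der_N {a : A} (ha : a ∈ I) (X : Derivation 𝕜 A A) :
    a • X ∈ (derTriple (baseTriple 𝕜 I)).N :=
  mem_der_N.2 fun _ => I.mul_mem_right _ ha

/-- The derivations preserving `I`, as a Lie–Rinehart subalgebra. -/
def tangentLR (𝕜 : Type*) [Field 𝕜] [Algebra 𝕜 A] (I : Ideal A) :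
    LieRinehartSubalgebra A (Derivation 𝕜 A A) where
  carrier := {X | ∀ a ∈ I, X a ∈ I}
  zero_mem' := fun _ _ => I.zero_mem
  add_mem' := fun hX hY a ha => I.add_mem (hX a ha) (hY a ha)
  smul_mem' := fun f _ hX a ha => I.mul_mem_left f (hX a ha)
  lie_mem' := fun hX hY => mem_der_W.1 (lie_mem_der_W (mem_der_W.2 hX) (mem_der_W.2 hY))

theorem symLR_le_der_W (hF : ∀ X ∈ F, ∀ a ∈ I, X a ∈ I) {X : Derivation 𝕜 A A}
    (hX : X ∈ symLR I F) : X ∈ (derTriple (baseTriple 𝕜 I)).W :=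
  mem_der_W.2 (symLR_le (S := tangentLR 𝕜 I) hF (fun _ hY a _ => mem_der_N.1 hY a) hX)

theorem isStrongConstraintLieRinehart_redLR (hF : ∀ X ∈ F, ∀ a ∈ I, X a ∈ I) :
    IsStrongConstraintLieRinehart (redAlg I F) (redLR I F) where
  strong :=
    { le := fun a ha X hX => mem_der_W.1 (symLR_le_der_W hF hX) a ha
      one_mem := fun X _ => by
        rw [Derivation.map_one_eq_zero]
        exact I.zero_mem
      mul_W := fun a ha b hb X hX => by
        rw [Derivation.leibniz]
        exact I.add_mem (I.mul_mem_left a (hb X hX)) (I.mul_mem_left b (ha X hX))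
      mul_N := fun a b hb => I.mul_mem_left a hb }
  le := fun X hX => ⟨symLR_le_der_W hF hX, fun Y hY => (symLR I F).lie_mem hY hX⟩
  lie_W := fun X hX X' hX' => ⟨lie_mem_der_W hX.1 hX'.1, fun Y hY => by
    rw [leibniz_lie]
    refine (symLR I F).add_mem ?_ ?_
    · exact hX'.2 _ (hX.2 Y hY)
    · rw [← lie_skew]
      exact neg_mem (hX.2 _ (hX'.2 Y hY))⟩
  lie_N := fun X hX X' hX' => by
    rw [← lie_skew]
    exact neg_mem (show ⁅X', X⁆ ∈ symLR I F from hX.2 X' hX')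
  smul_W := fun a ha X hX => ⟨(tangentLR 𝕜 I).smul_mem a (mem_der_W.1 hX.1) |> mem_der_W.2,
    fun Y hY => by
      -- The term Y(a) X is harmless: Y(a) ∈ I, so it takes values in I and lies in 𝔛₀ ⊆ 𝓕.
      have h : ⁅Y, a • X⁆ = a • ⁅Y, X⁆ + Y a • X := by
        ext b
        simp [Derivation.commutator_apply]
      rw [h]
      exact (symLR I F).add_mem ((symLR I F).smul_mem a (hX.2 Y hY))
        (mem_symLR_of_der_N (smul_mem_der_N (ha Y hY) X))⟩
  smul_N_left := fun a ha X => mem_symLR_of_der_N (smul_mem_der_N ha X)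
  smul_N_right := fun a X hX => (symLR I F).smul_mem a hX
  anchor_W := fun X hX => ⟨fun a ha Y hY => by
    have h : Y (X a) = ⁅Y, X⁆ a + X (Y a) := by simp [Derivation.commutator_apply]
    rw [h]
    exact I.add_mem (ha _ (hX.2 Y hY)) (mem_der_W.1 hX.1 _ (ha Y hY)), hX.1.2⟩
  anchor_N := fun X hX a ha => ha X hX

/-- By antisymmetry an argument from 𝔛₀ can be moved to the first slot. This turns statements about
B_W into statements about contractions in B_N, where the Cartan rules apply. -/
theorem mem_form_W {α : CE 𝕜 A} : α ∈ (formTriple 𝕜 I).W ↔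
    ∀ X ∈ (derTriple (baseTriple 𝕜 I)).N, contr X α ∈ (formTriple 𝕜 I).N := by
  constructor
  · intro h X hX n Z hZ
    rw [comp_contr_apply]
    exact (h (n + 1) (Matrix.vecCons X Z) (Fin.cases (der_N_le_W hX) hZ)).2 0 hX
  · intro h n Z hZ
    refine ⟨trivial, fun i hi => ?_⟩
    cases n with
    | zero => exact i.elim0
    | succ n =>
      have h1 := h (Z i) hi n (i.removeNth Z) fun j => hZ _
      rw [comp_contr_apply] at h1
      rw [← Function.update_eq_self i Z, form_update]
      exact zsmul_mem h1 _

theorem contr_mem_form_N {X : Derivation 𝕜 A A} (hX : X ∈ (derTriple (baseTriple 𝕜 I)).W)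
    {α : CE 𝕜 A} (hα : α ∈ (formTriple 𝕜 I).N) : contr X α ∈ (formTriple 𝕜 I).N := by
  intro n Z hZ
  rw [comp_contr_apply]
  exact hα (n + 1) _ (Fin.cases hX hZ)

theorem smul_mem_form_N (a : A) {α : CE 𝕜 A} (hα : α ∈ (formTriple 𝕜 I).N) :
    a • α ∈ (formTriple 𝕜 I).N := by
  intro n Z hZ
  rw [map_smul]
  exact I.mul_mem_left a (hα n Z hZ)

theorem smul_mem_form_N_of_mem {a : A} (ha : a ∈ I) (α : CE 𝕜 A) :
    a • α ∈ (formTriple 𝕜 I).N := by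
  intro n Z hZ
  rw [map_smul]
  exact I.mul_mem_right _ ha

theorem form_N_le_W : (formTriple 𝕜 I).N ≤ (formTriple 𝕜 I).W :=
  fun _ hα => mem_form_W.2 fun _ hX => contr_mem_form_N (der_N_le_W hX) hα

theorem contr_mem_form_W {X : Derivation 𝕜 A A} (hX : X ∈ (derTriple (baseTriple 𝕜 I)).W)
    {α : CE 𝕜 A} (hα : α ∈ (formTriple 𝕜 I).W) : contr X α ∈ (formTriple 𝕜 I).W :=
  mem_form_W.2 fun Y hY => by
    rw [contr_contr_swap]
    exact neg_mem (contr_mem_form_N hX (mem_form_W.1 hα Y hY))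

theorem smul_mem_form_W (a : A) {α : CE 𝕜 A} (hα : α ∈ (formTriple 𝕜 I).W) :
    a • α ∈ (formTriple 𝕜 I).W :=
  mem_form_W.2 fun Y hY => by
    rw [map_smul]
    exact smul_mem_form_N a (mem_form_W.1 hα Y hY)

theorem ceProj_mem_form_N (n : ℕ) {α : CE 𝕜 A} (hα : α ∈ (formTriple 𝕜 I).N) :
    ceProj n α ∈ (formTriple 𝕜 I).N := by
  intro m Z hZ
  by_cases h : n = m
  · subst h
    rw [comp_ceProj_same]
    exact hα n Z hZ
  · rw [comp_ceProj_ne h]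
    exact I.zero_mem

theorem ceProj_mem_form_W (n : ℕ) {α : CE 𝕜 A} (hα : α ∈ (formTriple 𝕜 I).W) :
    ceProj n α ∈ (formTriple 𝕜 I).W :=
  mem_form_W.2 fun Y hY => by
    cases n with
    | zero =>
      rw [contr_ceProj_zero]
      exact Submodule.zero_mem _
    | succ n =>
      rw [contr_ceProj_succ]
      exact ceProj_mem_form_N n (mem_form_W.1 hα Y hY)

variable [CharZero 𝕜]

/-- Each term of the differential has values in I, since the derivations preserving I are closed
under brackets. -/
theorem dCE_mem_form_N {α : CE 𝕜 A} (hα : α ∈ (formTriple 𝕜 I).N) :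
    dCE α ∈ (formTriple 𝕜 I).N := by
  intro n Z hZ
  cases n with
  | zero =>
    rw [comp_dCE_zero]
    exact I.zero_mem
  | succ n =>
    rw [comp_dCE_succ, ceDiff_apply, ceDiffFun]
    refine I.add_mem (I.sum_mem fun i _ => zsmul_mem ?_ _) ?_
    · exact mem_der_W.1 (hZ i) _ (hα n _ fun j => hZ _)
    · cases n with
      | zero => exact I.zero_mem
      | succ n =>
        refine I.sum_mem fun i _ => I.sum_mem fun j _ => zsmul_mem ?_ _
        exact hα (n + 1) _ (Fin.cases (lie_mem_der_W (hZ _) (hZ _)) fun l => hZ _)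

theorem lieDer_mem_form_N {X : Derivation 𝕜 A A} (hX : X ∈ (derTriple (baseTriple 𝕜 I)).W)
    {α : CE 𝕜 A} (hα : α ∈ (formTriple 𝕜 I).N) : lieDer X α ∈ (formTriple 𝕜 I).N :=
  Submodule.add_mem _ (contr_mem_form_N hX (dCE_mem_form_N hα))
    (dCE_mem_form_N (contr_mem_form_N hX hα))

/-- The leading term X(α(Z)) lies in I for any α, as X takes values in I. The other terms have [X,
Z_i] ∈ 𝔛₀ as an argument, so α ∈ B_W applies. -/
theorem lieDer_mem_form_N_of_mem {X : Derivation 𝕜 A A}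
    (hX : X ∈ (derTriple (baseTriple 𝕜 I)).N) {α : CE 𝕜 A} (hα : α ∈ (formTriple 𝕜 I).W) :
    lieDer X α ∈ (formTriple 𝕜 I).N := by
  intro n Z hZ
  rw [comp_lieDer_apply]
  refine I.sub_mem (mem_der_N.1 hX _) (I.sum_mem fun i _ => ?_)
  have hN : ⁅X, Z i⁆ ∈ (derTriple (baseTriple 𝕜 I)).N := lie_mem_der_N hX (hZ i)
  refine (hα n _ fun j => ?_).2 i (by rwa [Function.update_self])
  by_cases h : j = i
  · subst h
    rw [Function.update_self]
    exact der_N_le_W hN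
  · rw [Function.update_of_ne h]
    exact hZ j

/-- For X ∈ 𝔛₀ both terms of ι_X d = L_X - d ι_X map B_W to B_N. -/
theorem dCE_mem_form_W {α : CE 𝕜 A} (hα : α ∈ (formTriple 𝕜 I).W) :
    dCE α ∈ (formTriple 𝕜 I).W :=
  mem_form_W.2 fun X hX => by
    rw [contr_dCE]
    exact sub_mem (lieDer_mem_form_N_of_mem hX hα) (dCE_mem_form_N (mem_form_W.1 hα X hX))

theorem ceProj_mem_basic_W (n : ℕ) {α : CE 𝕜 A} (hα : α ∈ (basicTriple I F).W) :
    ceProj n α ∈ (basicTriple I F).W := by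
  refine ⟨ceProj_mem_form_W n hα.1, fun X hX => ⟨?_, ?_⟩⟩
  · cases n with
    | zero =>
      rw [contr_ceProj_zero]
      exact Submodule.zero_mem _
    | succ n =>
      rw [contr_ceProj_succ]
      exact ceProj_mem_form_N n (hα.2 X hX).1
  · rw [lieDer_ceProj]
    exact ceProj_mem_form_N n (hα.2 X hX).2

theorem isConstraintCartanCalculus_basicTriple (hF : ∀ X ∈ F, ∀ a ∈ I, X a ∈ I) :
    IsConstraintCartanCalculus (redAlg I F) (redLR I F) (basicTriple I F) := by
  have hd : ∀ α ∈ (basicTriple I F).W, dCE α ∈ (basicTriple I F).W := by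
    refine fun α hα => ⟨dCE_mem_form_W hα.1, fun X hX => ⟨?_, ?_⟩⟩
    · rw [contr_dCE]
      exact sub_mem (hα.2 X hX).2 (dCE_mem_form_N (hα.2 X hX).1)
    · rw [← dCE_lieDer]
      exact dCE_mem_form_N (hα.2 X hX).2
  have hι : ∀ X ∈ (redLR I F).W, ∀ α ∈ (basicTriple I F).W, contr X α ∈ (basicTriple I F).W := by
    refine fun X hX α hα => ⟨contr_mem_form_W hX.1 hα.1, fun Y hY => ⟨?_, ?_⟩⟩
    · rw [contr_contr_swap]
      exact neg_mem (contr_mem_form_N hX.1 (hα.2 Y hY).1)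
    · rw [lieDer_contr]
      -- The normalizer condition enters here: [Y, X] ∈ 𝓕, so its contraction with the basic form α
      -- lies in B_N.
      exact Submodule.add_mem _ (hα.2 _ (hX.2 Y hY)).1 (contr_mem_form_N hX.1 (hα.2 Y hY).2)
  exact
  { d_d := dCE_dCE
    contr_contr := contr_contr_add
    contr_smul := contr_smul_left
    d_lieDer := dCE_lieDer
    lieDer_smul := lieDer_smul_sub
    lieDer_contr := lieDer_contr_sub
    lieDer_lieDer := lieDer_lieDer_sub
    le := fun α hα => ⟨form_N_le_W hα, fun X hX =>
      ⟨contr_mem_form_N (symLR_le_der_W hF hX) hα, lieDer_mem_form_N (symLR_le_der_W hF hX) hα⟩⟩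
    graded_W := isGradedSubspace_of_ceProj_mem fun _ hα n => ceProj_mem_basic_W n hα
    graded_N := isGradedSubspace_of_ceProj_mem fun _ hα n => ceProj_mem_form_N n hα
    d_W := hd
    d_N := fun _ hα => dCE_mem_form_N hα
    smul_W := fun a ha α hα => ⟨smul_mem_form_W a hα.1, fun X hX => ⟨by
      rw [map_smul]
      exact smul_mem_form_N a (hα.2 X hX).1, by
      -- The extra term X(a) α lies in B_N because 𝓕 maps elements of the `W`-part of A' to I.
      rw [eq_add_of_sub_eq (lieDer_smul_sub X a α)]
      exact Submodule.add_mem _ (smul_mem_form_N_of_mem (ha X hX) α)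
        (smul_mem_form_N a (hα.2 X hX).2)⟩⟩
    smul_N_left := fun a ha α _ => smul_mem_form_N_of_mem ha α
    smul_N_right := fun a _ α hα => smul_mem_form_N a hα
    contr_W := hι
    contr_N_left := fun X hX α hα => (hα.2 X hX).1
    contr_N_right := fun X hX α hα => contr_mem_form_N hX.1 hα
    lieDer_W := fun X hX α hα =>
      Submodule.add_mem _ (hι X hX _ (hd α hα)) (hd _ (hι X hX α hα))
    lieDer_N_left := fun X hX α hα => (hα.2 X hX).2
    lieDer_N_right := fun X hX α hα => lieDer_mem_form_N hX.1 hα }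

/-- If `F` consists of symmetries of a closed `ω` in `B_W`, then so does the Lie–Rinehart algebra
generated by `F` and the derivations with values in `I`. -/
theorem contr_mem_form_N_of_mem_symLR (hF : ∀ X ∈ F, ∀ a ∈ I, X a ∈ I) {ω : CE 𝕜 A}
    (hω : dCE ω = 0) (hωF : ∀ X ∈ F, contr X ω ∈ (formTriple 𝕜 I).N)
    (hωW : ω ∈ (formTriple 𝕜 I).W) {X : Derivation 𝕜 A A} (hX : X ∈ symLR I F) :
    contr X ω ∈ (formTriple 𝕜 I).N := by
  -- By minimality of 𝓕 it suffices that these X form a Lie–Rinehart subalgebra containing F and 𝔛₀.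
  -- Preservation of I is part of the condition because closure under brackets needs L_X and ι_Y to
  -- preserve B_N.
  let S : LieRinehartSubalgebra A (Derivation 𝕜 A A) :=
    { carrier := {X | X ∈ tangentLR 𝕜 I ∧ contr X ω ∈ (formTriple 𝕜 I).N}
      zero_mem' := ⟨(tangentLR 𝕜 I).zero_mem, by
        rw [contr_zero_left]
        exact Submodule.zero_mem _⟩
      add_mem' := fun hX hY => ⟨(tangentLR 𝕜 I).add_mem hX.1 hY.1, by
        rw [contr_add]
        exact Submodule.add_mem _ hX.2 hY.2⟩
      smul_mem' := fun a X hX => ⟨(tangentLR 𝕜 I).smul_mem a hX.1, by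
        rw [contr_smul_left]
        exact smul_mem_form_N a hX.2⟩
      lie_mem' := fun {X Y} hX hY => ⟨(tangentLR 𝕜 I).lie_mem hX.1 hY.1, by
        -- Closedness of ω gives ι_[X,Y] ω = L_X ι_Y ω - ι_Y d ι_X ω, and both terms lie in B_N.
        have h : lieDer X ω = dCE (contr X ω) := by rw [lieDer, hω, map_zero, zero_add]
        rw [← lieDer_contr_sub, h]
        exact sub_mem (lieDer_mem_form_N (mem_der_W.2 hX.1) hY.2)
          (contr_mem_form_N (mem_der_W.2 hY.1) (dCE_mem_form_N hX.2))⟩ }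
  exact (symLR_le (S := S) (fun Y hY => ⟨hF Y hY, hωF Y hY⟩)
    (fun Y hY => ⟨mem_der_W.1 (der_N_le_W hY), mem_form_W.1 hωW Y hY⟩) hX).2

end Reduction

/-! ### Internal gradings and their projections -/

section Internal

variable {𝕜 M ι : Type*} [Field 𝕜] [AddCommGroup M] [Module 𝕜 M] [DecidableEq ι]
  {𝒢 : ι → Submodule 𝕜 M}

theorem isInternal_of_projections (π : ι → M →ₗ[𝕜] M) (hself : ∀ i, ∀ x ∈ 𝒢 i, π i x = x)
    (hne : ∀ i j, i ≠ j → ∀ x ∈ 𝒢 j, π i x = 0) (htop : ⨆ i, 𝒢 i = ⊤) :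
    DirectSum.IsInternal 𝒢 := by
  refine DirectSum.isInternal_submodule_of_iSupIndep_of_iSup_eq_top (fun i => ?_) htop
  rw [Submodule.disjoint_def]
  intro x hx hx'
  have h : ⨆ j, ⨆ (_ : j ≠ i), 𝒢 j ≤ LinearMap.ker (π i) :=
    iSup_le fun j => iSup_le fun hj y hy => hne i j hj.symm y hy
  rw [← hself i x hx]
  exact h hx'

theorem exists_projections (h : DirectSum.IsInternal 𝒢) :
    ∃ π : ι → M →ₗ[𝕜] M, (∀ i, ∀ x ∈ 𝒢 i, π i x = x) ∧
      ∀ i j, i ≠ j → ∀ x ∈ 𝒢 j, π i x = 0 := by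
  let e : (⨁ i, 𝒢 i) ≃ₗ[𝕜] M := LinearEquiv.ofBijective (DirectSum.coeLinearMap 𝒢) h
  have he : ∀ j (x : 𝒢 j), e.symm x = DirectSum.lof 𝕜 ι (fun i => 𝒢 i) j x := fun j x => by
    rw [LinearEquiv.symm_apply_eq]
    exact (DirectSum.coeLinearMap_lof 𝒢 j x).symm
  refine ⟨fun i => (𝒢 i).subtype ∘ₗ DirectSum.component 𝕜 ι (fun i => 𝒢 i) i ∘ₗ
    e.symm.toLinearMap, fun i x hx => ?_, fun i j hij x hx => ?_⟩
  · change ((DirectSum.component 𝕜 ι (fun i => 𝒢 i) i (e.symm x) : 𝒢 i) : M) = x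
    rw [he i ⟨x, hx⟩, DirectSum.component.lof_self]
  · change ((DirectSum.component 𝕜 ι (fun i => 𝒢 i) i (e.symm x) : 𝒢 i) : M) = 0
    rw [he j ⟨x, hx⟩, DirectSum.component.of, dif_neg hij.symm]
    rfl

end Internal

/-! ### Descent of multilinear maps to a quotient -/

section Quotient

variable {𝕜 M V : Type*} [Field 𝕜] [AddCommGroup M] [Module 𝕜 M] [AddCommGroup V] [Module 𝕜 V]

/-- Expanding f(y + (x - y)) over subsets of the slots, every term except f(y) has an argument in P.
-/
theorem multilinear_eq_of_sub_mem {n : ℕ} (f : MultilinearMap 𝕜 (fun _ : Fin n => M) V)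
    (P : Submodule 𝕜 M) (hf : ∀ x a, x a ∈ P → f x = 0) {x y : Fin n → M}
    (h : ∀ a, x a - y a ∈ P) : f x = f y := by
  have hxy : x = y + (x - y) := by abel
  rw [hxy, f.map_add_univ, Finset.sum_eq_single_of_mem Finset.univ (Finset.mem_univ _),
    Finset.piecewise_univ]
  intro s _ hs
  obtain ⟨a, ha⟩ : ∃ a, a ∉ s := by
    by_contra hcon
    push Not at hcon
    exact hs (Finset.eq_univ_of_forall hcon)
  exact hf _ a (by rw [Finset.piecewise_eq_of_notMem _ _ _ ha]; exact h a)

theorem quotient_mk_out (P : Submodule 𝕜 M) (x : M ⧸ P) :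
    (Submodule.Quotient.mk x.out : M ⧸ P) = x :=
  Quotient.out_eq x

theorem out_sub_mem (P : Submodule 𝕜 M) (x : M) :
    (Submodule.Quotient.mk x : M ⧸ P).out - x ∈ P :=
  (Submodule.Quotient.eq P).1 (Quotient.out_eq _)

theorem multilinear_update_out {n : ℕ} (f : MultilinearMap 𝕜 (fun _ : Fin n => M) V)
    (P : Submodule 𝕜 M) (hf : ∀ x a, x a ∈ P → f x = 0) (x : Fin n → M ⧸ P) (i : Fin n)
    {w : M ⧸ P} {w' : M} (hw : Submodule.Quotient.mk w' = w) :
    f (fun a => (Function.update x i w a).out) =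
      f (Function.update (fun a => (x a).out) i w') := by
  subst hw
  refine multilinear_eq_of_sub_mem f P hf fun a => ?_
  by_cases ha : a = i
  · subst ha
    simpa using out_sub_mem P w'
  · simp [ha]

/-- A multilinear map that vanishes as soon as one argument lies in `P` descends to `M ⧸ P`. -/
noncomputable def quotientMultilinear {n : ℕ} (f : MultilinearMap 𝕜 (fun _ : Fin n => M) V)
    (P : Submodule 𝕜 M) (hf : ∀ x a, x a ∈ P → f x = 0) :
    MultilinearMap 𝕜 (fun _ : Fin n => M ⧸ P) V where
  -- Chosen representatives suffice: the value does not depend on them, by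
  -- `multilinear_eq_of_sub_mem`.
  toFun x := f fun a => (x a).out
  map_update_add' := by
    intro inst x i u v
    obtain rfl : inst = instDecidableEqFin n := Subsingleton.elim _ _
    rw [multilinear_update_out f P hf x i (w := u + v) (w' := u.out + v.out)
        (by rw [Submodule.Quotient.mk_add, quotient_mk_out, quotient_mk_out]),
      multilinear_update_out f P hf x i (quotient_mk_out P u),
      multilinear_update_out f P hf x i (quotient_mk_out P v), f.map_update_add]
  map_update_smul' := by
    intro inst x i c u
    obtain rfl : inst = instDecidableEqFin n := Subsingleton.elim _ _
    rw [multilinear_update_out f P hf x i (w := c • u) (w' := c • u.out)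
        (by rw [Submodule.Quotient.mk_smul, quotient_mk_out]),
      multilinear_update_out f P hf x i (quotient_mk_out P u), f.map_update_smul]

theorem quotientMultilinear_mk {n : ℕ} (f : MultilinearMap 𝕜 (fun _ : Fin n => M) V)
    (P : Submodule 𝕜 M) (hf : ∀ x a, x a ∈ P → f x = 0) (x : Fin n → M) :
    quotientMultilinear f P hf (fun a => Submodule.Quotient.mk (x a)) = f x :=
  multilinear_eq_of_sub_mem f P hf fun a => out_sub_mem P (x a)

end Quotient

/-! ### Reduction of a constraint `L∞`-algebra -/

section Reduced

variable {𝕜 T : Type*} [Field 𝕜] [AddCommGroup T] [Module 𝕜 T] {𝒢 : ℤ → Submodule 𝕜 T}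
  {C : ConstraintTriple 𝕜 T}

theorem mem_of_projection {ι : Type*} {𝒢 : ι → Submodule 𝕜 T} {S : Submodule 𝕜 T}
    (hS : IsGradedSubspace 𝒢 S)
    (π : ι → T →ₗ[𝕜] T) (hself : ∀ i, ∀ x ∈ 𝒢 i, π i x = x)
    (hne : ∀ i j, i ≠ j → ∀ x ∈ 𝒢 j, π i x = 0) (i : ι) {x : T} (hx : x ∈ S) : π i x ∈ S := by
  have h : ⨆ j, S ⊓ 𝒢 j ≤ S.comap (π i) := by
    refine iSup_le fun j y hy => ?_
    change π i y ∈ S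
    by_cases hij : i = j
    · subst hij
      rw [hself i y hy.2]
      exact hy.1
    · rw [hne i j hij y hy.2]
      exact S.zero_mem
  exact h (hS ▸ hx)

/-- The projections onto the homogeneous parts preserve the graded subspaces W and N, hence descend
to W / N and separate the induced grading there. -/
theorem isInternal_redGrading (h : DirectSum.IsInternal 𝒢) (hW : IsGradedSubspace 𝒢 C.W)
    (hN : IsGradedSubspace 𝒢 C.N) : DirectSum.IsInternal (C.redGrading 𝒢) := by
  obtain ⟨π, hself, hne⟩ := exists_projections h
  have hπW : ∀ i, ∀ x ∈ C.W, π i x ∈ C.W := fun i x hx => mem_of_projection hW π hself hne i hx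
  refine isInternal_of_projections
    (fun i => Submodule.mapQ (C.N.comap C.W.subtype) (C.N.comap C.W.subtype)
      ((π i).restrict (hπW i))
      fun x hx => mem_of_projection hN π hself hne i (x := (x : T)) hx) ?_ ?_ ?_
  · rintro i _ ⟨x, hx, rfl⟩
    exact congrArg (C.N.comap C.W.subtype).mkQ (Subtype.ext (hself i x hx))
  · rintro i j hij _ ⟨x, hx, rfl⟩
    have h0 : (π i).restrict (hπW i) x = 0 := Subtype.ext (hne i j hij x hx)
    exact (congrArg (C.N.comap C.W.subtype).mkQ h0).trans (map_zero _)
  · refine eq_top_iff.2 ?_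
    rintro x -
    obtain ⟨x, rfl⟩ := Submodule.mkQ_surjective _ x
    have key : ∀ y ∈ ⨆ i, C.W ⊓ 𝒢 i, ∀ hy : y ∈ C.W,
        (C.N.comap C.W.subtype).mkQ ⟨y, hy⟩ ∈ ⨆ i, C.redGrading 𝒢 i := by
      intro y hy
      induction hy using Submodule.iSup_induction' with
      | mem i y hy => exact fun hyW =>
          Submodule.mem_iSup_of_mem i ⟨⟨y, hyW⟩, hy.2, rfl⟩
      | zero =>
        intro hyW
        have h0 := Submodule.zero_mem (⨆ i, C.redGrading 𝒢 i)
        rwa [← map_zero (C.N.comap C.W.subtype).mkQ] at h0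
      | add y z hy hz ihy ihz =>
        intro hyz
        have hW' : ⨆ i, C.W ⊓ 𝒢 i ≤ C.W := iSup_le fun i => inf_le_left
        have := Submodule.add_mem _ (ihy (hW' hy)) (ihz (hW' hz))
        rwa [← map_add] at this
    exact key x (hW ▸ x.2) x.2

/-- Homogeneous classes have homogeneous representatives in W, so the axioms, which concern only
homogeneous arguments, can be checked upstairs. -/
theorem exists_homogeneous_lift {n : ℕ} {d : Fin n → ℤ} {x : Fin n → C.Red}
    (hx : ∀ a, x a ∈ C.redGrading 𝒢 (d a)) :
    ∃ y : Fin n → C.W, (∀ a, (y a : T) ∈ 𝒢 (d a)) ∧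
      x = fun a => Submodule.Quotient.mk (y a) := by
  choose y hy hyx using hx
  exact ⟨y, hy, funext fun a => (hyx a).symm⟩

variable (L : LInftyAlgebra 𝕜 𝒢) (hL : IsConstraintLInfty L C)

/-- The multibrackets of a constraint `L∞`-algebra, restricted to `W`. -/
def LInftyAlgebra.bracketW (n : ℕ) : MultilinearMap 𝕜 (fun _ : Fin n => C.W) C.W :=
  ((L.bracket n).compLinearMap fun _ => C.W.subtype).codRestrict C.W fun x =>
    hL.bracket_W n _ fun a => (x a).2

/-- The multibrackets induced on `W / N` by a constraint `L∞`-algebra. -/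
noncomputable def LInftyAlgebra.redBracket (n : ℕ) :
    MultilinearMap 𝕜 (fun _ : Fin n => C.Red) C.Red :=
  quotientMultilinear ((C.N.comap C.W.subtype).mkQ.compMultilinearMap (L.bracketW hL n))
    (C.N.comap C.W.subtype) fun x a ha =>
      (Submodule.Quotient.mk_eq_zero _).2 (hL.bracket_N n _ (fun a => (x a).2) a ha)

theorem LInftyAlgebra.redBracket_mk (n : ℕ) (x : Fin n → C.W) :
    L.redBracket hL n (fun a => Submodule.Quotient.mk (x a)) =
      Submodule.Quotient.mk (L.bracketW hL n x) :=
  quotientMultilinear_mk _ _ _ x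

/-- The reduction `W / N` of a constraint `L∞`-algebra. -/
noncomputable def LInftyAlgebra.reduction : LInftyAlgebra 𝕜 (C.redGrading 𝒢) where
  isInternal := isInternal_redGrading L.isInternal hL.graded_W hL.graded_N
  bracket := L.redBracket hL
  bracket_zero := by
    ext x
    obtain rfl : x = fun a => Submodule.Quotient.mk (Fin.elim0 a) := Subsingleton.elim _ _
    rw [LInftyAlgebra.redBracket_mk]
    refine (Submodule.Quotient.mk_eq_zero _).2 ?_
    change L.bracket 0 _ ∈ C.N
    rw [L.bracket_zero]
    exact C.N.zero_mem
  degree := by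
    intro n d x hx
    obtain ⟨y, hy, rfl⟩ := exists_homogeneous_lift hx
    rw [LInftyAlgebra.redBracket_mk]
    exact ⟨_, L.degree n d _ hy, rfl⟩
  antisymm := by
    intro n d x σ hx
    obtain ⟨y, hy, rfl⟩ := exists_homogeneous_lift hx
    have h := L.antisymm n d _ σ hy
    rw [L.redBracket_mk hL n y, L.redBracket_mk hL n fun a => y (σ a)]
    exact congrArg (C.N.comap C.W.subtype).mkQ
      (show L.bracketW hL n (fun a => y (σ a)) = koszulSign σ d • L.bracketW hL n y from
        Subtype.ext h)
  jacobi := by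
    intro n d x hx
    obtain ⟨y, hy, rfl⟩ := exists_homogeneous_lift hx
    have h := L.jacobi n d _ hy
    have hterm : ∀ (p : Fin n) (σ : Equiv.Perm (Fin n)),
        L.redBracket hL (n - (p + 1) + 1)
          (Fin.cons (L.redBracket hL (p + 1)
              fun a : Fin (p + 1) => Submodule.Quotient.mk (y (σ ⟨a, by omega⟩)))
            fun b : Fin (n - (p + 1)) => Submodule.Quotient.mk (y (σ ⟨p + 1 + b, by omega⟩))) =
        Submodule.Quotient.mk (L.bracketW hL (n - (p + 1) + 1)
          (Fin.cons (L.bracketW hL (p + 1) fun a : Fin (p + 1) => y (σ ⟨a, by omega⟩))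
            fun b : Fin (n - (p + 1)) => y (σ ⟨p + 1 + b, by omega⟩))) := by
      intro p σ
      rw [← L.redBracket_mk hL]
      congr 1
      funext a
      cases a using Fin.cases with
      | zero => exact L.redBracket_mk hL _ fun a : Fin (p + 1) => y (σ ⟨a, by omega⟩)
      | succ b => rfl
    have hW : ∑ p : Fin n, ∑ σ ∈ unshuffles n (p + 1),
        (-1 : ℤ) ^ (((p : ℕ) + 1) * (n - (p + 1))) • koszulSign σ d •
          L.bracketW hL (n - (p + 1) + 1)
            (Fin.cons (L.bracketW hL (p + 1) fun a : Fin (p + 1) => y (σ ⟨a, by omega⟩))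
              fun b : Fin (n - (p + 1)) => y (σ ⟨p + 1 + b, by omega⟩)) = 0 := by
      -- The identity on W is the one on the total space, read through the inclusion; it is then
      -- pushed to the quotient.
      refine C.W.injective_subtype ?_
      rw [map_zero, ← h, map_sum]
      refine Finset.sum_congr rfl fun p _ => ?_
      rw [map_sum]
      refine Finset.sum_congr rfl fun σ _ => ?_
      rw [map_zsmul, Units.smul_def, map_zsmul, Units.smul_def]
      congr 2
      refine congrArg (L.bracket _) (funext fun a => ?_)
      cases a using Fin.cases <;> rfl
    have h0 := congrArg (C.N.comap C.W.subtype).mkQ hW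
    rw [map_zero, map_sum] at h0
    rw [← h0]
    refine Finset.sum_congr rfl fun p _ => ?_
    rw [map_sum]
    refine Finset.sum_congr rfl fun σ _ => ?_
    rw [map_zsmul, Units.smul_def, Units.smul_def, map_zsmul, hterm]
    rfl

theorem LInftyAlgebra.reduction_bracket_mk (n : ℕ) (x : Fin n → C.W) (y : C.W)
    (h : (y : T) = L.bracket n fun a => (x a : T)) :
    (L.reduction hL).bracket n (fun a => Submodule.Quotient.mk (x a)) =
      Submodule.Quotient.mk y := by
  refine (L.redBracket_mk hL n x).trans (congrArg Submodule.Quotient.mk (Subtype.ext ?_))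
  exact h.symm

end Reduced

/-! ### Koszul signs and the (2, n)-unshuffles -/

section Shuffles

/-- In degree 0 each inversion contributes -1. -/
theorem koszulSign_of_eq_zero {n : ℕ} (σ : Equiv.Perm (Fin n)) {d : Fin n → ℤ}
    (hd : ∀ a, d a = 0) : koszulSign σ d = Equiv.Perm.sign σ := by
  rw [Equiv.Perm.sign_eq_prod_prod_Ioi, koszulSign, Finset.prod_filter, Fintype.prod_prod_type]
  refine Finset.prod_congr rfl fun i _ => ?_
  rw [show Finset.Ioi i = Finset.univ.filter (i < ·) by ext; simp, Finset.prod_filter]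
  refine Finset.prod_congr rfl fun j _ => ?_
  by_cases hij : i < j
  · have hne : σ i ≠ σ j := fun h => hij.ne (σ.injective h)
    by_cases h : σ i < σ j
    · simp [hij, h, h.not_gt]
    · have h' : σ j < σ i := lt_of_le_of_ne (not_lt.1 h) hne.symm
      simp [hij, h, h', hd]
  · simp [hij]

theorem perm_eq_one_of_strictMono {n : ℕ} {σ : Equiv.Perm (Fin n)} (h : StrictMono σ) : σ = 1 :=
  Equiv.ext fun a => congrFun ((h.range_inj strictMono_id).1 (by simp)) a

theorem unshuffles_self (n : ℕ) : unshuffles n n = {1} := by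
  ext σ
  simp only [unshuffles, Finset.mem_filter, Finset.mem_univ, true_and, Finset.mem_singleton]
  constructor
  · exact fun h => perm_eq_one_of_strictMono fun a b hab => h a b hab (Or.inl b.2)
  · rintro rfl a b hab -
    exact hab

/-- The unshuffle that brings `i.castSucc` and `j.succ` to the front, for `i ≤ j`. -/
def twoShuffle {n : ℕ} (i j : Fin (n + 1)) : Equiv.Perm (Fin (n + 2)) :=
  i.castSucc.cycleRange.symm * Equiv.Perm.decomposeFin.symm (0, j.cycleRange.symm)

theorem twoShuffle_zero {n : ℕ} (i j : Fin (n + 1)) : twoShuffle i j 0 = i.castSucc := by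
  simp [twoShuffle]

theorem twoShuffle_succ_zero {n : ℕ} (i j : Fin (n + 1)) :
    twoShuffle i j (Fin.succ 0) = i.castSucc.succAbove j := by
  simp [twoShuffle, -Fin.succ_zero_eq_one]

theorem twoShuffle_one {n : ℕ} {i j : Fin (n + 1)} (h : i ≤ j) : twoShuffle i j 1 = j.succ := by
  rw [← Fin.succ_zero_eq_one, twoShuffle_succ_zero,
    Fin.succAbove_of_le_castSucc _ _ (Fin.castSucc_le_castSucc_iff.2 h)]

theorem twoShuffle_succ_succ {n : ℕ} (i j : Fin (n + 1)) (a : Fin n) :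
    twoShuffle i j a.succ.succ = i.castSucc.succAbove (j.succAbove a) := by
  simp [twoShuffle, Equiv.Perm.decomposeFin_symm_apply_succ]

theorem sign_twoShuffle {n : ℕ} (i j : Fin (n + 1)) :
    Equiv.Perm.sign (twoShuffle i j) = (-1) ^ ((i : ℕ) + j) := by
  simp [twoShuffle, pow_add]

theorem twoShuffle_mem {n : ℕ} {i j : Fin (n + 1)} (h : i ≤ j) :
    twoShuffle i j ∈ unshuffles (n + 2) 2 := by
  simp only [unshuffles, Finset.mem_filter, Finset.mem_univ, true_and]
  intro a b hab hb
  cases b using Fin.cases with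
  | zero => exact absurd hab (by simp)
  | succ b =>
    cases b using Fin.cases with
    | zero =>
      cases a using Fin.cases with
      | zero =>
        rw [Fin.succ_zero_eq_one, twoShuffle_zero, twoShuffle_one h]
        exact Fin.castSucc_lt_succ_iff.2 h
      | succ a => exact absurd hab (by simp)
    | succ b =>
      have ha : 2 ≤ (a : ℕ) := hb.resolve_left (by simp)
      cases a using Fin.cases with
      | zero => simp at ha
      | succ a =>
        cases a using Fin.cases with
        | zero => simp at ha
        | succ a =>
          rw [twoShuffle_succ_succ, twoShuffle_succ_succ]
          exact Fin.strictMono_succAbove _ (Fin.strictMono_succAbove _ (by simpa using hab))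

theorem range_perm_succ_succ {n : ℕ} (σ : Equiv.Perm (Fin (n + 2))) :
    Set.range (fun a : Fin n => σ a.succ.succ) = {σ 0, σ 1}ᶜ := by
  ext b
  obtain ⟨c, rfl⟩ := σ.surjective b
  simp only [Set.mem_range, EmbeddingLike.apply_eq_iff_eq, Set.mem_compl_iff, Set.mem_insert_iff,
    Set.mem_singleton_iff]
  cases c using Fin.cases with
  | zero => simp [Fin.succ_ne_zero]
  | succ c =>
    cases c using Fin.cases with
    | zero => simp [Fin.ext_iff]
    | succ c => simp [Fin.ext_iff]

/-- An unshuffle is determined by its first two values: the remaining ones list their complement in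
increasing order. -/
theorem exists_eq_twoShuffle {n : ℕ} {σ : Equiv.Perm (Fin (n + 2))}
    (hσ : σ ∈ unshuffles (n + 2) 2) : ∃ i j : Fin (n + 1), i ≤ j ∧ twoShuffle i j = σ := by
  simp only [unshuffles, Finset.mem_filter, Finset.mem_univ, true_and] at hσ
  have h01 : σ 0 < σ 1 := hσ 0 1 (by simp) (Or.inl (by simp))
  have hlt : (σ 0 : ℕ) < σ 1 := h01
  have hle : (σ 1 : ℕ) < n + 2 := (σ 1).2
  have hij : (⟨σ 0, by omega⟩ : Fin (n + 1)) ≤ ⟨(σ 1 : ℕ) - 1, by omega⟩ := by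
    rw [Fin.mk_le_mk]
    omega
  -- The pair p < q is encoded by i = p and j = q - 1, as in the differential.
  refine ⟨⟨σ 0, by omega⟩, ⟨(σ 1 : ℕ) - 1, by omega⟩, hij, ?_⟩
  set τ := twoShuffle (⟨σ 0, by omega⟩ : Fin (n + 1)) ⟨(σ 1 : ℕ) - 1, by omega⟩ with hτ
  have h0 : τ 0 = σ 0 := twoShuffle_zero _ _
  have h1 : τ 1 = σ 1 := by
    rw [hτ, twoShuffle_one hij]
    ext
    simp only [Fin.succ_mk]
    omega
  have hτ' : StrictMono fun a : Fin n => τ a.succ.succ := by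
    intro a b hab
    change τ a.succ.succ < τ b.succ.succ
    rw [hτ, twoShuffle_succ_succ, twoShuffle_succ_succ]
    exact Fin.strictMono_succAbove _ (Fin.strictMono_succAbove _ hab)
  have hσ' : StrictMono fun a : Fin n => σ a.succ.succ := fun a b hab =>
    hσ _ _ (by simpa using hab) (Or.inr (by simp))
  have h := (hτ'.range_inj hσ').1 (by
    rw [range_perm_succ_succ, range_perm_succ_succ, h0, h1])
  ext a : 1
  cases a using Fin.cases with
  | zero => exact h0
  | succ a =>
    cases a using Fin.cases with
    | zero => exact h1
    | succ a => exact congrFun h a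

/-- Brings the Jacobi sum into the index form of `dCE_iterContr`, so that the two can be compared
term by term. -/
theorem sum_unshuffles_two {M : Type*} [AddCommMonoid M] {n : ℕ}
    (f : Equiv.Perm (Fin (n + 2)) → M) :
    ∑ σ ∈ unshuffles (n + 2) 2, f σ = ∑ i : Fin (n + 1), ∑ j ≥ i, f (twoShuffle i j) := by
  rw [Finset.sum_sigma']
  symm
  refine Finset.sum_bij (fun q _ => twoShuffle q.1 q.2) ?_ ?_ ?_ fun _ _ => rfl
  · rintro ⟨i, j⟩ h
    exact twoShuffle_mem (by simpa using h)
  · rintro ⟨i, j⟩ h ⟨i', j'⟩ h' heq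
    have hij : i ≤ j := by simpa using h
    have hij' : i' ≤ j' := by simpa using h'
    have h0 := congrArg (fun σ => σ 0) heq
    have h1 := congrArg (fun σ => σ 1) heq
    simp only [twoShuffle_zero, twoShuffle_one hij, twoShuffle_one hij'] at h0 h1
    rw [Fin.castSucc_injective _ h0, Fin.succ_injective _ h1]
  · intro σ hσ
    obtain ⟨i, j, hij, h⟩ := exists_eq_twoShuffle hσ
    exact ⟨⟨i, j⟩, by simpa using hij, h⟩

end Shuffles

/-! ### Iterated contractions and their differential -/

section IteratedContraction

variable {𝕜 A : Type*} [Field 𝕜] [CommRing A] [Algebra 𝕜 A]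

theorem iterContr_zero (X : Fin 0 → Derivation 𝕜 A A) (α : CE 𝕜 A) : iterContr X α = α := rfl

theorem iterContr_succ {n : ℕ} (X : Fin (n + 1) → Derivation 𝕜 A A) (α : CE 𝕜 A) :
    iterContr X α = contr (X 0) (iterContr (Fin.tail X) α) := by
  rw [iterContr, List.ofFn_succ]
  rfl

theorem iterContr_update_add {n : ℕ} (X : Fin n → Derivation 𝕜 A A) (i : Fin n)
    (U V : Derivation 𝕜 A A) (α : CE 𝕜 A) :
    iterContr (Function.update X i (U + V)) α =
      iterContr (Function.update X i U) α + iterContr (Function.update X i V) α := by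
  induction n with
  | zero => exact i.elim0
  | succ n ih =>
    rw [iterContr_succ, iterContr_succ, iterContr_succ]
    cases i using Fin.cases with
    | zero => simp only [Fin.tail_update_zero, Function.update_self, contr_add]
    | succ i =>
      simp only [Fin.tail_update_succ, Function.update_of_ne (Fin.succ_ne_zero i).symm, ih,
        map_add]

theorem iterContr_update_smul {n : ℕ} (X : Fin n → Derivation 𝕜 A A) (i : Fin n) (c : 𝕜)
    (U : Derivation 𝕜 A A) (α : CE 𝕜 A) :
    iterContr (Function.update X i (c • U)) α = c • iterContr (Function.update X i U) α := by
  induction n with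
  | zero => exact i.elim0
  | succ n ih =>
    rw [iterContr_succ, iterContr_succ]
    cases i using Fin.cases with
    | zero => simp only [Fin.tail_update_zero, Function.update_self, contr_smul]
    | succ i =>
      simp only [Fin.tail_update_succ, Function.update_of_ne (Fin.succ_ne_zero i).symm, ih]
      exact LinearMap.map_smul_of_tower _ c _

/-- Contractions anticommute, so ι_{X_i} can be moved next to its second copy, where ι_X² = 0. -/
theorem contr_iterContr_eq_zero {n : ℕ} (X : Fin n → Derivation 𝕜 A A) (i : Fin n)
    (α : CE 𝕜 A) : contr (X i) (iterContr X α) = 0 := by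
  induction n with
  | zero => exact i.elim0
  | succ n ih =>
    rw [iterContr_succ]
    cases i using Fin.cases with
    | zero => exact contr_contr_self _ _
    | succ i => rw [contr_contr_swap, show X i.succ = Fin.tail X i from rfl, ih, map_zero, neg_zero]

theorem iterContr_eq_zero_of_eq {n : ℕ} (X : Fin n → Derivation 𝕜 A A) (i j : Fin n)
    (h : X i = X j) (hij : i ≠ j) (α : CE 𝕜 A) : iterContr X α = 0 := by
  induction n with
  | zero => exact i.elim0
  | succ n ih =>
    rw [iterContr_succ]
    cases i using Fin.cases with
    | zero =>
      cases j using Fin.cases with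
      | zero => exact absurd rfl hij
      | succ j => rw [h, show X j.succ = Fin.tail X j from rfl, contr_iterContr_eq_zero]
    | succ i =>
      cases j using Fin.cases with
      | zero => rw [← h, show X i.succ = Fin.tail X i from rfl, contr_iterContr_eq_zero]
      | succ j => rw [ih (Fin.tail X) i j h fun e => hij (congrArg Fin.succ e), map_zero]

/-- The iterated contraction as an alternating map. -/
def iterContrAlt (n : ℕ) (α : CE 𝕜 A) : Derivation 𝕜 A A [⋀^Fin n]→ₗ[𝕜] CE 𝕜 A where
  toFun X := iterContr X α
  map_update_add' := by
    intro inst X i U V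
    obtain rfl : inst = instDecidableEqFin n := Subsingleton.elim _ _
    exact iterContr_update_add X i U V α
  map_update_smul' := by
    intro inst X i c U
    obtain rfl : inst = instDecidableEqFin n := Subsingleton.elim _ _
    exact iterContr_update_smul X i c U α
  map_eq_zero_of_eq' := fun X i j h hij => iterContr_eq_zero_of_eq X i j h hij α

theorem iterContr_mem_cePart {n : ℕ} (X : Fin n → Derivation 𝕜 A A) {α : CE 𝕜 A} {m : ℤ}
    (h : α ∈ cePart m) : iterContr X α ∈ cePart (m - n) := by
  induction n with
  | zero => simpa [iterContr_zero] using h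
  | succ n ih =>
    rw [iterContr_succ, show m - ((n + 1 : ℕ) : ℤ) = m - n - 1 by push_cast; ring]
    exact contr_mem_cePart _ (ih _)

theorem iterContr_succ_removeNth {n : ℕ} (j : Fin (n + 1)) (X : Fin (n + 2) → Derivation 𝕜 A A)
    (α : CE 𝕜 A) : iterContr (j.succ.removeNth X) α =
      contr (X 0) (iterContr (j.removeNth (Fin.tail X)) α) := by
  rw [iterContr_succ]
  congr 2
  funext a
  simp [Fin.removeNth, Fin.tail, Fin.succ_succAbove_succ]

variable [CharZero 𝕜]

/-- L_X acts on the string of contractions by the Leibniz rule; the sign comes from moving ι_[X,Y_j]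
to the front past j contractions. -/
theorem lieDer_iterContr {n : ℕ} (X : Derivation 𝕜 A A) (Y : Fin (n + 1) → Derivation 𝕜 A A)
    {ω : CE 𝕜 A} (hX : lieDer X ω = 0) :
    lieDer X (iterContr Y ω) =
      ∑ j : Fin (n + 1), (-1 : ℤ) ^ (j : ℕ) • contr ⁅X, Y j⁆ (iterContr (j.removeNth Y) ω) := by
  induction n with
  | zero =>
    rw [iterContr_succ, iterContr_zero, lieDer_contr, hX, map_zero]
    simp [iterContr_zero]
  | succ n ih =>
    rw [iterContr_succ, lieDer_contr, ih, map_sum, Fin.sum_univ_succ (n := n + 1)]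
    congr 1
    · simp only [Fin.val_zero, pow_zero, one_smul]
      rfl
    · refine Finset.sum_congr rfl fun j _ => ?_
      rw [map_zsmul, contr_contr_swap, iterContr_succ_removeNth, Fin.val_succ, pow_succ,
        mul_neg_one, neg_smul, smul_neg]
      rfl

/-- The hypotheses say that every L_{X_i} annihilates ω. In d ι_{X_0} = L_{X_0} - ι_{X_0} d, the Lie
derivative produces the pairs containing X_0 and the induction hypothesis the others; the minus sign
is absorbed by moving ι_{X_0} past the contraction with a bracket. This is the analytic content of
the higher Jacobi identities. -/
theorem dCE_iterContr {n : ℕ} (X : Fin (n + 2) → Derivation 𝕜 A A) {ω : CE 𝕜 A}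
    (hω : dCE ω = 0) (hX : ∀ i, dCE (contr (X i) ω) = 0) :
    dCE (iterContr X ω) = ∑ i : Fin (n + 1), ∑ j ≥ i, (-1 : ℤ) ^ ((i : ℕ) + j) •
      contr ⁅X i.castSucc, X j.succ⁆
        (iterContr (j.removeNth (i.castSucc.removeNth X)) ω) := by
  have hL : ∀ i, lieDer (X i) ω = 0 := fun i => by
    rw [lieDer, hω, hX, map_zero, add_zero]
  induction n with
  | zero =>
    rw [iterContr_succ, dCE_contr, lieDer_iterContr _ _ (hL 0), iterContr_succ, iterContr_zero,
      show Fin.tail X 0 = X 1 from rfl, hX, map_zero, sub_zero]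
    rw [Fin.sum_univ_one, Fin.sum_univ_one]
    simp [iterContr_zero, Fin.tail]
  | succ n ih =>
    rw [iterContr_succ, dCE_contr, lieDer_iterContr _ _ (hL 0),
      ih (Fin.tail X) (fun i => hX _) fun i => hL _, sub_eq_add_neg]
    refine Eq.trans ?_ (Fin.sum_univ_succ _).symm
    congr 1
    · rw [show Finset.Ici (0 : Fin (n + 2)) = Finset.univ by ext; simp]
      refine Finset.sum_congr rfl fun j _ => ?_
      simp only [Fin.val_zero, zero_add]
      rfl
    · rw [map_sum, ← Finset.sum_neg_distrib]
      refine Finset.sum_congr rfl fun i _ => ?_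
      rw [Fin.sum_Ici_succ, map_sum, ← Finset.sum_neg_distrib]
      refine Finset.sum_congr rfl fun j _ => ?_
      rw [map_zsmul, contr_contr_swap, smul_neg, neg_neg, iterContr_succ_removeNth]
      congr 1
      · rw [Fin.val_succ, Fin.val_succ]
        ring
      · congr 3
        funext a
        simp [Fin.removeNth, Fin.tail, Fin.succ_succAbove_succ]

end IteratedContraction

theorem koszulSign_one {n : ℕ} (d : Fin n → ℤ) : koszulSign 1 d = 1 := by
  refine Finset.prod_eq_one fun q hq => ?_
  have h := (Finset.mem_filter.1 hq).2
  exact absurd h.1 h.2.not_gt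

/-! ### Higher brackets as alternating maps of vector fields -/

section LieBracket

variable {𝕜 A : Type*} [Field 𝕜] [CommRing A] [Algebra 𝕜 A]

/-- The Lie bracket as an alternating map in two arguments, and zero for other arities. -/
def lieAlt (𝕜 A : Type*) [Field 𝕜] [CommRing A] [Algebra 𝕜 A] :
    ∀ n : ℕ, Derivation 𝕜 A A [⋀^Fin n]→ₗ[𝕜] Derivation 𝕜 A A
  | 0 => 0
  | 1 => 0
  | 2 =>
    { toFun := fun X => ⁅X 0, X 1⁆
      map_update_add' := by
        intro inst X i U V
        obtain rfl : inst = instDecidableEqFin 2 := Subsingleton.elim _ _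
        fin_cases i <;> simp
      map_update_smul' := by
        intro inst X i c U
        obtain rfl : inst = instDecidableEqFin 2 := Subsingleton.elim _ _
        fin_cases i <;> simp
      map_eq_zero_of_eq' := by
        intro X i j h hij
        fin_cases i <;> fin_cases j <;> simp_all }
  | _ + 3 => 0

theorem lieAlt_of_ne {n : ℕ} (hn : n ≠ 2) : lieAlt 𝕜 A n = 0 := by
  match n, hn with
  | 0, _ => rfl
  | 1, _ => rfl
  | _ + 3, _ => rfl

/-- The value of the `n`-ary bracket of the observables, `n ≥ 2`, on vector fields. -/
def higherAlt (ω : CE 𝕜 A) (n : ℕ) :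
    Derivation 𝕜 A A [⋀^Fin n]→ₗ[𝕜] (CE 𝕜 A × Derivation 𝕜 A A) :=
  (-1 : ℤ) ^ (n + 1) • (LinearMap.inl 𝕜 (CE 𝕜 A) (Derivation 𝕜 A A)).compAlternatingMap
      (iterContrAlt n ω) +
    (LinearMap.inr 𝕜 (CE 𝕜 A) (Derivation 𝕜 A A)).compAlternatingMap (lieAlt 𝕜 A n)

theorem higherAlt_apply (n : ℕ) (X : Fin n → Derivation 𝕜 A A) :
    higherAlt ω n X = ((-1 : ℤ) ^ (n + 1) • iterContr X ω, lieAlt 𝕜 A n X) := by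
  refine Prod.ext ?_ ?_
  · simp [higherAlt]
    rfl
  · simp [higherAlt]

end LieBracket

/-! ### The graded space of observables and its brackets, with k = m + 1 -/

section Observables

variable {𝕜 A : Type*} [Field 𝕜] [CharZero 𝕜] [CommRing A] [Algebra 𝕜 A] {m : ℕ} {ω : CE 𝕜 A}

theorem mem_hamPart_zero {k : ℕ} {x : CE 𝕜 A × Derivation 𝕜 A A} :
    x ∈ hamPart k ω 0 ↔ x.1 ∈ cePart ((k : ℤ) - 1) ∧ contr x.2 ω = -dCE x.1 := by
  rw [hamPart, if_pos rfl]
  rfl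

theorem mem_hamPart_neg {k : ℕ} {x : CE 𝕜 A × Derivation 𝕜 A A} {i : ℤ} (hi : i < 0) :
    x ∈ hamPart k ω i ↔ x.1 ∈ cePart ((k : ℤ) - 1 + i) ∧ x.2 = 0 := by
  rw [hamPart, if_neg hi.ne, if_pos hi]
  rfl

theorem eq_zero_of_mem_hamPart {k : ℕ} {x : CE 𝕜 A × Derivation 𝕜 A A} {i : ℤ} (hi : 0 < i)
    (hx : x ∈ hamPart k ω i) : x = 0 := by
  rw [hamPart, if_neg hi.ne', if_neg hi.not_gt] at hx
  exact hx

theorem fst_mem_of_mem_hamPart {k : ℕ} {x : CE 𝕜 A × Derivation 𝕜 A A} {i : ℤ}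
    (hx : x ∈ hamPart k ω i) : x.1 ∈ cePart ((k : ℤ) - 1 + i) := by
  rcases lt_trichotomy i 0 with hi | rfl | hi
  · exact ((mem_hamPart_neg hi).1 hx).1
  · simpa using (mem_hamPart_zero.1 hx).1
  · rw [eq_zero_of_mem_hamPart hi hx]
    exact Submodule.zero_mem _

theorem snd_eq_zero_of_mem_hamPart {k : ℕ} {x : CE 𝕜 A × Derivation 𝕜 A A} {i : ℤ} (hi : i ≠ 0)
    (hx : x ∈ hamPart k ω i) : x.2 = 0 := by
  rcases hi.lt_or_gt with hi | hi
  · exact ((mem_hamPart_neg hi).1 hx).2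
  · rw [eq_zero_of_mem_hamPart hi hx]
    rfl

theorem mem_hamGrading {k : ℕ} {x : ham k ω} {i : ℤ} :
    x ∈ hamGrading k ω i ↔ (x : CE 𝕜 A × Derivation 𝕜 A A) ∈ hamPart k ω i :=
  Iff.rfl

theorem mk_zero_mem_hamPart {k : ℕ} {β : CE 𝕜 A} {i : ℤ} (hi : i ≤ 0)
    (hβ : β ∈ cePart ((k : ℤ) - 1 + i)) (hd : i = 0 → dCE β = 0) :
    ((β, 0) : CE 𝕜 A × Derivation 𝕜 A A) ∈ hamPart k ω i := by
  rcases hi.lt_or_eq with hi | rfl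
  · exact (mem_hamPart_neg hi).2 ⟨hβ, rfl⟩
  · refine mem_hamPart_zero.2 ⟨by simpa using hβ, ?_⟩
    rw [contr_zero_left, hd rfl, neg_zero]

theorem hamPart_le_ham {k : ℕ} (i : ℤ) : hamPart k ω i ≤ ham k ω := le_iSup (hamPart k ω) i

/-- The Hamiltonian condition for inhomogeneous elements: parts of nonzero degree have neither a
vector field nor a form of degree m. It makes the brackets definable on all of Ham, not only on
homogeneous elements. -/
theorem ham_contr {x : CE 𝕜 A × Derivation 𝕜 A A} (hx : x ∈ ham (m + 1) ω) :
    contr x.2 ω = -dCE (ceProj m x.1) := by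
  induction hx using Submodule.iSup_induction' with
  | mem i x hx =>
    rcases eq_or_ne i 0 with rfl | hi
    · rw [mem_hamPart_zero] at hx
      rw [hx.2, ceProj_of_mem (by simpa using hx.1)]
    · rw [snd_eq_zero_of_mem_hamPart hi hx, contr_zero_left,
        ceProj_of_mem_ne (fst_mem_of_mem_hamPart hx) (by push_cast; omega), map_zero, neg_zero]
  | zero => simp [contr_zero_left]
  | add x y _ _ hx hy =>
    rw [Prod.snd_add, Prod.fst_add, contr_add, hx, hy, map_add, map_add, neg_add]

theorem ham_comp {x : CE 𝕜 A × Derivation 𝕜 A A} (hx : x ∈ ham (m + 1) ω) :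
    ∀ n ≥ m + 1, CE.comp 𝕜 A n x.1 = 0 := by
  intro n hn
  induction hx using Submodule.iSup_induction' with
  | mem i x hx =>
    rcases le_or_gt i 0 with hi | hi
    · exact fst_mem_of_mem_hamPart hx n (by push_cast; omega)
    · rw [eq_zero_of_mem_hamPart hi hx]
      exact map_zero _
  | zero => exact map_zero _
  | add x y _ _ hx hy => rw [Prod.fst_add, map_add, hx, hy, add_zero]

theorem dCE_contr_of_mem_ham {x : CE 𝕜 A × Derivation 𝕜 A A} (hx : x ∈ ham (m + 1) ω) :
    dCE (contr x.2 ω) = 0 := by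
  rw [ham_contr hx, map_neg, dCE_dCE, neg_zero]

theorem ham_decomposition {x : CE 𝕜 A × Derivation 𝕜 A A} (hx : x ∈ ham (m + 1) ω) :
    x = ∑ n ∈ Finset.range m, (ceProj n x.1, 0) + (ceProj m x.1, x.2) := by
  have h := CE.eq_sum_ceProj (ham_comp hx)
  rw [Finset.sum_range_succ] at h
  refine Prod.ext ?_ ?_
  · rw [Prod.fst_add, Prod.fst_sum]
    exact h
  · rw [Prod.snd_add, Prod.snd_sum, Finset.sum_const_zero, zero_add]

theorem lower_mem_hamPart {n : ℕ} (hn : n < m) (α : CE 𝕜 A) :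
    ((ceProj n α, 0) : CE 𝕜 A × Derivation 𝕜 A A) ∈ hamPart (m + 1) ω ((n : ℤ) - m) := by
  refine mk_zero_mem_hamPart (by omega) ?_ (by omega)
  have h := ceProj_mem_cePart n α
  rwa [show (((m + 1 : ℕ) : ℤ) - 1 + ((n : ℤ) - m)) = n by push_cast; ring]

theorem top_mem_hamPart {x : CE 𝕜 A × Derivation 𝕜 A A} (hx : x ∈ ham (m + 1) ω) :
    (ceProj m x.1, x.2) ∈ hamPart (m + 1) ω 0 := by
  have hc := ham_contr hx
  refine mem_hamPart_zero.2 ⟨?_, hc⟩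
  have h := ceProj_mem_cePart m x.1
  rwa [show (((m + 1 : ℕ) : ℤ) - 1) = m by push_cast; ring]

/-- The homogeneous parts of (α, X) are the components of α below degree m, with zero vector field,
and the degree-m component together with X. -/
theorem isGradedSubspace_hamGrading {S : Submodule 𝕜 (CE 𝕜 A × Derivation 𝕜 A A)}
    (hlow : ∀ x ∈ S, ∀ n, (ceProj n x.1, 0) ∈ S) (htop : ∀ x ∈ S, (ceProj m x.1, x.2) ∈ S) :
    IsGradedSubspace (hamGrading (m + 1) ω) (S.comap (ham (m + 1) ω).subtype) := by
  refine le_antisymm ?_ (iSup_le fun i => inf_le_left)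
  rintro ⟨x, hx⟩ hxS
  let y : ℕ → ham (m + 1) ω := fun n =>
    if hn : n < m then ⟨(ceProj n x.1, 0), hamPart_le_ham _ (lower_mem_hamPart hn x.1)⟩ else 0
  have hy : ∀ n ∈ Finset.range m, (y n : CE 𝕜 A × Derivation 𝕜 A A) = (ceProj n x.1, 0) :=
    fun n hn => by simp only [y, dif_pos (Finset.mem_range.1 hn)]
  have hdec : (⟨x, hx⟩ : ham (m + 1) ω) = ∑ n ∈ Finset.range m, y n +
      ⟨(ceProj m x.1, x.2), hamPart_le_ham _ (top_mem_hamPart hx)⟩ := by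
    refine Subtype.ext ?_
    rw [Submodule.coe_add, Submodule.coe_sum, Finset.sum_congr rfl hy]
    exact ham_decomposition hx
  rw [hdec]
  refine Submodule.add_mem _ (Submodule.sum_mem _ fun n hn => ?_) ?_
  · refine Submodule.mem_iSup_of_mem ((n : ℤ) - m) ⟨?_, ?_⟩
    · change (y n : CE 𝕜 A × Derivation 𝕜 A A) ∈ S
      rw [hy n hn]
      exact hlow x hxS n
    · change (y n : CE 𝕜 A × Derivation 𝕜 A A) ∈ hamPart (m + 1) ω _
      rw [hy n hn]
      exact lower_mem_hamPart (Finset.mem_range.1 hn) x.1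
  · exact Submodule.mem_iSup_of_mem 0 ⟨htop x hxS, top_mem_hamPart hx⟩

theorem isInternal_hamGrading : DirectSum.IsInternal (hamGrading (m + 1) ω) := by
  refine DirectSum.isInternal_submodule_of_iSupIndep_of_iSup_eq_top (fun i => ?_) ?_
  -- K consists of the elements with zero part of degree i: no form of degree m + i and, for i = 0,
  -- no vector field.
  · let K : Submodule 𝕜 (ham (m + 1) ω) :=
      { carrier := {x | (∀ n : ℕ, (n : ℤ) = m + i → CE.comp 𝕜 A n x.1.1 = 0) ∧
          (i = 0 → x.1.2 = 0)}
        zero_mem' := ⟨fun _ _ => map_zero _, fun _ => rfl⟩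
        add_mem' := fun {x y} hx hy => ⟨fun n hn => by
          rw [Submodule.coe_add, Prod.fst_add, map_add, hx.1 n hn, hy.1 n hn, add_zero],
          fun hi => by rw [Submodule.coe_add, Prod.snd_add, hx.2 hi, hy.2 hi, add_zero]⟩
        smul_mem' := fun c x hx => ⟨fun n hn => by
          rw [Submodule.coe_smul, Prod.smul_fst, LinearMap.map_smul_of_tower, hx.1 n hn,
            smul_zero],
          fun hi => by rw [Submodule.coe_smul, Prod.smul_snd, hx.2 hi, smul_zero]⟩ }
    have hK : ⨆ j, ⨆ (_ : j ≠ i), hamGrading (m + 1) ω j ≤ K := by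
      refine iSup_le fun j => iSup_le fun hj x hx => ⟨fun n hn => ?_, fun hi => ?_⟩
      · exact fst_mem_of_mem_hamPart hx n (by push_cast; omega)
      · exact snd_eq_zero_of_mem_hamPart (by omega) hx
    rw [Submodule.disjoint_def]
    intro x hx hx'
    have hxK := hK hx'
    refine Subtype.ext (Prod.ext (CE.ext_comp fun n => ?_) ?_)
    · by_cases hn : (n : ℤ) = m + i
      · exact (hxK.1 n hn).trans (map_zero _).symm
      · exact (fst_mem_of_mem_hamPart hx n (by push_cast; omega)).trans (map_zero _).symm
    · by_cases hi : i = 0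
      · exact hxK.2 hi
      · exact snd_eq_zero_of_mem_hamPart hi hx
  · have h : IsGradedSubspace (hamGrading (m + 1) ω)
        ((⊤ : Submodule 𝕜 (CE 𝕜 A × Derivation 𝕜 A A)).comap (ham (m + 1) ω).subtype) :=
      isGradedSubspace_hamGrading (fun _ _ _ => trivial) fun _ _ => trivial
    rw [IsGradedSubspace, Submodule.comap_top] at h
    simpa using h.symm

theorem hamDiff_mem {x : CE 𝕜 A × Derivation 𝕜 A A} (hx : x ∈ ham (m + 1) ω) :
    ((dCE (x.1 - ceProj m x.1), 0) : CE 𝕜 A × Derivation 𝕜 A A) ∈ ham (m + 1) ω := by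
  have h := CE.eq_sum_ceProj (ham_comp hx)
  rw [Finset.sum_range_succ, ← sub_eq_iff_eq_add] at h
  have h' : ((dCE (x.1 - ceProj m x.1), 0) : CE 𝕜 A × Derivation 𝕜 A A) =
      ∑ n ∈ Finset.range m, (dCE (ceProj n x.1), 0) := by
    refine Prod.ext ?_ ?_
    · rw [Prod.fst_sum, h, map_sum]
    · rw [Prod.snd_sum, Finset.sum_const_zero]
  rw [h']
  refine Submodule.sum_mem _ fun n hn => ?_
  have hn' := Finset.mem_range.1 hn
  refine hamPart_le_ham ((n : ℤ) + 1 - m) (mk_zero_mem_hamPart (by omega) ?_ fun _ => dCE_dCE _)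
  have h1 := dCE_mem_cePart (ceProj_mem_cePart n x.1)
  rwa [show (((m + 1 : ℕ) : ℤ) - 1 + ((n : ℤ) + 1 - m)) = n + 1 by push_cast; ring]

/-- The unary bracket of the observables: `d` on the forms of degree below `m`. -/
def hamDiff (m : ℕ) (ω : CE 𝕜 A) : ham (m + 1) ω →ₗ[𝕜] ham (m + 1) ω where
  -- Removing the component of degree m makes l_1 vanish in degree 0 while remaining linear on the
  -- total space.
  toFun x := ⟨(dCE (x.1.1 - ceProj m x.1.1), 0), hamDiff_mem x.2⟩
  map_add' x y := by
    refine Subtype.ext (Prod.ext ?_ (add_zero _).symm)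
    simp only [Submodule.coe_add, Prod.fst_add, map_add, map_sub]
    abel
  map_smul' c x := by
    refine Subtype.ext (Prod.ext ?_ (smul_zero c).symm)
    have h : ceProj m (c • x.1.1) = c • ceProj m x.1.1 := LinearMap.map_smul_of_tower _ c _
    simp only [Submodule.coe_smul, Prod.smul_fst, h, ← smul_sub, map_smul, RingHom.id_apply]

theorem hamDiff_coe (x : ham (m + 1) ω) :
    (hamDiff m ω x : CE 𝕜 A × Derivation 𝕜 A A) = (dCE (x.1.1 - ceProj m x.1.1), 0) :=
  rfl

theorem hamDiff_of_mem_zero {x : ham (m + 1) ω} (hx : x ∈ hamGrading (m + 1) ω 0) :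
    hamDiff m ω x = 0 := by
  refine Subtype.ext (Prod.ext ?_ rfl)
  change dCE (x.1.1 - ceProj m x.1.1) = 0
  rw [ceProj_of_mem (by simpa using fst_mem_of_mem_hamPart (mem_hamGrading.1 hx)), sub_self,
    map_zero]

theorem hamDiff_of_mem_ne {x : ham (m + 1) ω} {i : ℤ} (hi : i ≠ 0)
    (hx : x ∈ hamGrading (m + 1) ω i) :
    (hamDiff m ω x : CE 𝕜 A × Derivation 𝕜 A A) = (dCE x.1.1, 0) := by
  change ((dCE (x.1.1 - ceProj m x.1.1), 0) : CE 𝕜 A × Derivation 𝕜 A A) = _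
  rw [ceProj_of_mem_ne (fst_mem_of_mem_hamPart (mem_hamGrading.1 hx)) (by push_cast; omega),
    sub_zero]

theorem hamDiff_mem_hamGrading {x : ham (m + 1) ω} {i : ℤ}
    (hx : x ∈ hamGrading (m + 1) ω i) : hamDiff m ω x ∈ hamGrading (m + 1) ω (i + 1) := by
  rcases lt_trichotomy i 0 with hi | rfl | hi
  · change (hamDiff m ω x : CE 𝕜 A × Derivation 𝕜 A A) ∈ hamPart (m + 1) ω (i + 1)
    rw [hamDiff_of_mem_ne hi.ne hx]
    refine mk_zero_mem_hamPart (by omega) ?_ fun _ => dCE_dCE _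
    rw [← add_assoc]
    exact dCE_mem_cePart (fst_mem_of_mem_hamPart hx)
  · rw [hamDiff_of_mem_zero hx]
    exact Submodule.zero_mem _
  · rw [show x = 0 from Subtype.ext (eq_zero_of_mem_hamPart hi hx), map_zero]
    exact Submodule.zero_mem _

theorem hamDiff_hamDiff (x : ham (m + 1) ω) : hamDiff m ω (hamDiff m ω x) = 0 := by
  refine Subtype.ext (Prod.ext ?_ rfl)
  change dCE (dCE (x.1.1 - ceProj m x.1.1) - ceProj m (dCE (x.1.1 - ceProj m x.1.1))) = 0
  rw [map_sub, dCE_ceProj, dCE_dCE, map_zero, sub_zero]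

/-- For two arguments the Hamiltonian condition has to be verified; it is d ι_X ι_Y ω = ι_[X,Y] ω.
For more arguments only the form degree matters. -/
theorem higherAlt_mem {n : ℕ} (hω : dCE ω = 0) (hdeg : ω ∈ cePart ((m : ℤ) + 2))
    (X : Fin (n + 2) → Derivation 𝕜 A A) (hX : ∀ i, dCE (contr (X i) ω) = 0) :
    higherAlt ω (n + 2) X ∈ hamPart (m + 1) ω (-(n : ℤ)) := by
  have h := iterContr_mem_cePart X hdeg
  rw [higherAlt_apply]
  cases n with
  | zero =>
    rw [Nat.cast_zero, neg_zero]
    refine mem_hamPart_zero.2 ⟨zsmul_mem (by simpa using h) _, ?_⟩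
    change contr ⁅X 0, X 1⁆ ω = _
    rw [map_zsmul, dCE_iterContr X hω hX, Fin.sum_univ_one]
    simp [iterContr_zero]
  | succ n =>
    refine (mem_hamPart_neg (by omega)).2 ⟨zsmul_mem ?_ _, ?_⟩
    · rwa [show (m : ℤ) + 2 - ((n + 1 + 2 : ℕ) : ℤ) =
        ((m + 1 : ℕ) : ℤ) - 1 + -((n + 1 : ℕ) : ℤ) by push_cast; ring] at h
    · rw [lieAlt_of_ne (by omega)]
      rfl

/-- The multibrackets of the `L∞`-algebra of observables. -/
def hamBracket (hω : dCE ω = 0) (hdeg : ω ∈ cePart ((m : ℤ) + 2)) :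
    ∀ n : ℕ, MultilinearMap 𝕜 (fun _ : Fin n => ham (m + 1) ω) (ham (m + 1) ω)
  | 0 => 0
  | 1 => MultilinearMap.ofSubsingleton 𝕜 _ _ 0 (hamDiff m ω)
  | n + 2 => ((higherAlt ω (n + 2)).toMultilinearMap.compLinearMap fun _ =>
      LinearMap.snd 𝕜 _ _ ∘ₗ (ham (m + 1) ω).subtype).codRestrict _ fun x =>
        hamPart_le_ham _ (higherAlt_mem hω hdeg _ fun i => dCE_contr_of_mem_ham (x i).2)

variable (hω : dCE ω = 0) (hdeg : ω ∈ cePart ((m : ℤ) + 2))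

theorem hamBracket_of_eq_one {n : ℕ} (hn : n = 1) (x : Fin n → ham (m + 1) ω) :
    hamBracket hω hdeg n x = hamDiff m ω (x ⟨0, by omega⟩) := by
  subst hn
  rfl

theorem hamBracket_of_two_le {n : ℕ} (hn : 2 ≤ n) (x : Fin n → ham (m + 1) ω) :
    (hamBracket hω hdeg n x : CE 𝕜 A × Derivation 𝕜 A A) =
      higherAlt ω n fun a => (x a).1.2 := by
  obtain ⟨n, rfl⟩ := Nat.exists_eq_add_of_le' hn
  rfl

theorem hamBracket_eq_zero {n : ℕ} (hn : 2 ≤ n) (x : Fin n → ham (m + 1) ω) (a : Fin n)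
    (ha : (x a).1.2 = 0) : hamBracket hω hdeg n x = 0 := by
  refine Subtype.ext ?_
  rw [hamBracket_of_two_le hω hdeg hn]
  exact (higherAlt ω n).map_coord_zero a ha

theorem hamBracket_snd {n : ℕ} (hn : n ≠ 2) (x : Fin n → ham (m + 1) ω) :
    (hamBracket hω hdeg n x).1.2 = 0 := by
  match n, hn with
  | 0, _ => rfl
  | 1, _ => rfl
  | n + 3, _ =>
    rw [hamBracket_of_two_le hω hdeg (by omega), higherAlt_apply, lieAlt_of_ne (by omega)]
    rfl

theorem hamBracket_mem_hamPart {n : ℕ} (hn : 2 ≤ n) (x : Fin n → ham (m + 1) ω) :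
    hamBracket hω hdeg n x ∈ hamGrading (m + 1) ω (2 - n) := by
  obtain ⟨n, rfl⟩ := Nat.exists_eq_add_of_le' hn
  have h := higherAlt_mem hω hdeg _ fun i => dCE_contr_of_mem_ham (x i).2
  rwa [show -(n : ℤ) = 2 - ((n + 2 : ℕ) : ℤ) by push_cast; ring] at h

theorem hamBracket_degree (n : ℕ) (d : Fin n → ℤ) (x : Fin n → ham (m + 1) ω)
    (hx : ∀ a, x a ∈ hamGrading (m + 1) ω (d a)) :
    hamBracket hω hdeg n x ∈ hamGrading (m + 1) ω (∑ a, d a + 2 - n) := by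
  match n, d, x, hx with
  | 0, _, _, _ => exact Submodule.zero_mem _
  | 1, d, x, hx =>
    rw [hamBracket_of_eq_one hω hdeg rfl, Fin.sum_univ_one,
      show d 0 + 2 - ((1 : ℕ) : ℤ) = d 0 + 1 by push_cast; ring]
    exact hamDiff_mem_hamGrading (hx 0)
  | n + 2, d, x, hx =>
    by_cases hd : ∀ a, d a = 0
    · rw [Finset.sum_eq_zero fun a _ => hd a, zero_add]
      exact hamBracket_mem_hamPart hω hdeg (by omega) x
    · push Not at hd
      obtain ⟨a, ha⟩ := hd
      rw [hamBracket_eq_zero hω hdeg (by omega) x a (snd_eq_zero_of_mem_hamPart ha (hx a))]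
      exact Submodule.zero_mem _

theorem hamBracket_antisymm (n : ℕ) (d : Fin n → ℤ) (x : Fin n → ham (m + 1) ω)
    (σ : Equiv.Perm (Fin n)) (hx : ∀ a, x a ∈ hamGrading (m + 1) ω (d a)) :
    hamBracket hω hdeg n (fun a => x (σ a)) = koszulSign σ d • hamBracket hω hdeg n x := by
  rcases lt_or_ge n 2 with hn | hn
  · have : Subsingleton (Fin n) := Fin.subsingleton_iff_le_one.2 (by omega)
    obtain rfl : σ = 1 := Subsingleton.elim _ _
    rw [koszulSign_one, one_smul]
    rfl
  · by_cases hd : ∀ a, d a = 0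
    · refine Subtype.ext ?_
      rw [koszulSign_of_eq_zero σ hd, Units.smul_def, Submodule.coe_smul_of_tower,
        hamBracket_of_two_le hω hdeg hn, hamBracket_of_two_le hω hdeg hn]
      exact (higherAlt ω n).map_perm (fun a => (x a).1.2) σ
    · push Not at hd
      obtain ⟨a, ha⟩ := hd
      have h := snd_eq_zero_of_mem_hamPart ha (hx a)
      rw [hamBracket_eq_zero hω hdeg hn x a h,
        hamBracket_eq_zero hω hdeg hn _ (σ.symm a) (by simpa using h), smul_zero]

end Observables

/-! ### The vector field component of the Jacobi identity -/

section LieJacobi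

variable {𝕜 A : Type*} [Field 𝕜] [CommRing A] [Algebra 𝕜 A]

/-- With three arguments this is the Jacobi identity of derivations; with more, the outer bracket
has no vector field component. -/
theorem sum_lieAlt_eq_zero {r : ℕ} (X : Fin (r + 3) → Derivation 𝕜 A A) :
    ∑ i : Fin (r + 2), ∑ j ≥ i, (-1 : ℤ) ^ ((i : ℕ) + j) •
      lieAlt 𝕜 A (r + 2) (Fin.cons ⁅X i.castSucc, X j.succ⁆
        (j.removeNth (i.castSucc.removeNth X))) = 0 := by
  cases r with
  | zero =>
    have h0 : Finset.Ici (0 : Fin 2) = {0, 1} := rfl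
    have h1 : Finset.Ici (1 : Fin 2) = {1} := rfl
    have e : ∀ Y Z : Derivation 𝕜 A A, ∀ f : Fin 1 → Derivation 𝕜 A A, f 0 = Z →
        lieAlt 𝕜 A 2 (Fin.cons Y f) = ⁅Y, Z⁆ := by
      rintro Y _ f rfl
      rfl
    rw [Fin.sum_univ_two, h0, h1, Finset.sum_singleton, Finset.sum_pair (by decide),
      e _ (X 2) _ rfl, e _ (X 1) _ rfl, e _ (X 0) _ rfl]
    have hJ := lie_jacobi (X 0) (X 1) (X 2)
    have s1 := lie_skew (X 0) ⁅X 1, X 2⁆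
    have s2 := lie_skew (X 1) ⁅X 2, X 0⁆
    have s3 := lie_skew (X 2) ⁅X 0, X 1⁆
    have s4 : ⁅⁅X 2, X 0⁆, X 1⁆ = -⁅⁅X 0, X 2⁆, X 1⁆ := by
      rw [← neg_lie, lie_skew]
    change (-1 : ℤ) ^ 0 • ⁅⁅X 0, X 1⁆, X 2⁆ + (-1 : ℤ) ^ 1 • ⁅⁅X 0, X 2⁆, X 1⁆ +
      (-1 : ℤ) ^ 2 • ⁅⁅X 1, X 2⁆, X 0⁆ = 0
    rw [← s1, ← s2, ← s3, s4] at hJ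
    rw [← neg_eq_zero, ← hJ]
    simp only [pow_zero, pow_one, one_smul, neg_smul, neg_one_sq]
    abel
  | succ r =>
    rw [lieAlt_of_ne (by omega)]
    simp

end LieJacobi

/-! ### The generalized Jacobi identities -/

section Jacobi

variable {𝕜 A : Type*} [Field 𝕜] [CharZero 𝕜] [CommRing A] [Algebra 𝕜 A] {m : ℕ} {ω : CE 𝕜 A}
  (hω : dCE ω = 0) (hdeg : ω ∈ cePart ((m : ℤ) + 2))

theorem hamBracket_cons_of_eq_zero {n : ℕ} (hn : n = 0) (y : ham (m + 1) ω)
    (z : Fin n → ham (m + 1) ω) :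
    hamBracket hω hdeg (n + 1) (Fin.cons y z) = hamDiff m ω y := by
  subst hn
  rfl

theorem hamBracket_two_snd (x : Fin 2 → ham (m + 1) ω) :
    (hamBracket hω hdeg 2 x).1.2 = ⁅(x 0).1.2, (x 1).1.2⁆ := by
  rw [hamBracket_of_two_le hω hdeg le_rfl, higherAlt_apply]
  rfl

/-- The composition of two multibrackets of the observables in the Jacobi identity. -/
def hamJacobiTerm {n : ℕ} (x : Fin n → ham (m + 1) ω) (p : Fin n) (σ : Equiv.Perm (Fin n)) :
    ham (m + 1) ω :=
  hamBracket hω hdeg (n - (p + 1) + 1)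
    (Fin.cons (hamBracket hω hdeg (p + 1) fun a : Fin (p + 1) => x (σ ⟨a, by omega⟩))
      fun b : Fin (n - (p + 1)) => x (σ ⟨p + 1 + b, by omega⟩))

/-- An inner bracket other than l_2 has zero vector field, and an outer bracket of arity at least 2
then vanishes. -/
theorem hamJacobiTerm_of_ne {n : ℕ} (x : Fin n → ham (m + 1) ω) (p : Fin n)
    (σ : Equiv.Perm (Fin n)) (hp : (p : ℕ) + 1 ≠ n) (hp' : (p : ℕ) ≠ 1) :
    hamJacobiTerm hω hdeg x p σ = 0 :=
  hamBracket_eq_zero hω hdeg (by omega) _ 0 (hamBracket_snd hω hdeg (by omega) _)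

theorem hamJacobiTerm_last {n : ℕ} (x : Fin n → ham (m + 1) ω) (p : Fin n)
    (σ : Equiv.Perm (Fin n)) (hp : (p : ℕ) + 1 = n) :
    hamJacobiTerm hω hdeg x p σ =
      hamDiff m ω (hamBracket hω hdeg (p + 1) fun a : Fin (p + 1) => x (σ ⟨a, by omega⟩)) :=
  hamBracket_cons_of_eq_zero hω hdeg (by omega) _ _

theorem hamJacobiTerm_of_snd_eq_zero {n : ℕ} (hn : 2 ≤ n) (x : Fin n → ham (m + 1) ω) (p : Fin n)
    (σ : Equiv.Perm (Fin n)) (a : Fin n) (ha : (x a).1.2 = 0) :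
    hamJacobiTerm hω hdeg x p σ = 0 := by
  obtain ⟨b, rfl⟩ := σ.surjective a
  by_cases hp : (p : ℕ) + 1 = n
  · rw [hamJacobiTerm_last hω hdeg x p σ hp,
      hamBracket_eq_zero hω hdeg (by omega) _ ⟨b, by omega⟩ ha, map_zero]
  by_cases hp' : (p : ℕ) = 1
  · rcases lt_or_ge (b : ℕ) (p + 1) with hb | hb
    · refine hamBracket_eq_zero hω hdeg (by omega) _ 0 ?_
      rw [Fin.cons_zero, hamBracket_eq_zero hω hdeg (by omega) _ ⟨b, hb⟩ ha]
      rfl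
    · refine hamBracket_eq_zero hω hdeg (by omega) _
        (Fin.succ ⟨b - (p + 1), by omega⟩) ?_
      rw [Fin.cons_succ]
      have hb' : (⟨p + 1 + (b - (p + 1)), by omega⟩ : Fin n) = b := Fin.ext (by simp; omega)
      simpa only [hb'] using ha
  · exact hamJacobiTerm_of_ne hω hdeg x p σ hp hp'

theorem hamDiff_hamBracket {r : ℕ} (x : Fin (r + 3) → ham (m + 1) ω) :
    (hamDiff m ω (hamBracket hω hdeg (r + 3) x) : CE 𝕜 A × Derivation 𝕜 A A) =
      ((-1 : ℤ) ^ (r + 4) • dCE (iterContr (fun a => (x a).1.2) ω), 0) := by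
  rw [hamDiff_of_mem_ne (i := 2 - ((r + 3 : ℕ) : ℤ)) (by omega)
    (hamBracket_mem_hamPart hω hdeg (by omega) x), hamBracket_of_two_le hω hdeg (by omega),
    higherAlt_apply, map_zsmul]

theorem hamJacobiTerm_twoShuffle {r : ℕ} (x : Fin (r + 3) → ham (m + 1) ω) {i j : Fin (r + 2)}
    (hij : i ≤ j) :
    (hamJacobiTerm hω hdeg x ⟨1, by omega⟩ (twoShuffle i j) : CE 𝕜 A × Derivation 𝕜 A A) =
      higherAlt ω (r + 2) (Fin.cons ⁅(x i.castSucc).1.2, (x j.succ).1.2⁆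
        (j.removeNth (i.castSucc.removeNth fun a => (x a).1.2))) := by
  refine (hamBracket_of_two_le hω hdeg (n := r + 2) (by omega) _).trans ?_
  congr 1
  funext a
  cases a using Fin.cases with
  | zero =>
    refine (hamBracket_two_snd hω hdeg _).trans ?_
    change ⁅(x (twoShuffle i j 0)).1.2, (x (twoShuffle i j 1)).1.2⁆ = _
    rw [twoShuffle_zero, twoShuffle_one hij]
    rfl
  | succ a =>
    change (x (twoShuffle i j ⟨2 + a, by omega⟩)).1.2 = _
    rw [show (⟨2 + a, by omega⟩ : Fin (r + 3)) = a.succ.succ from Fin.ext (by simp; omega),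
      twoShuffle_succ_succ]
    rfl

theorem hamBracket_jacobi (n : ℕ) (d : Fin n → ℤ) (x : Fin n → ham (m + 1) ω)
    (hx : ∀ a, x a ∈ hamGrading (m + 1) ω (d a)) :
    ∑ p : Fin n, ∑ σ ∈ unshuffles n (p + 1),
      (-1 : ℤ) ^ (((p : ℕ) + 1) * (n - (p + 1))) • koszulSign σ d •
        hamJacobiTerm hω hdeg x p σ = 0 := by
  by_cases hd : ∀ a, d a = 0
  · match n, d, x, hx, hd with
    | 0, _, _, _, _ => rfl
    | 1, d, x, hx, _ =>
      refine Finset.sum_eq_zero fun p _ => Finset.sum_eq_zero fun σ _ => ?_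
      have hp : (p : ℕ) + 1 = 1 := by omega
      rw [hamJacobiTerm_last hω hdeg x p σ hp, hamBracket_of_eq_one hω hdeg hp,
        hamDiff_hamDiff, smul_zero, smul_zero]
    | 2, d, x, hx, _ =>
      refine Finset.sum_eq_zero fun p _ => Finset.sum_eq_zero fun σ _ => ?_
      suffices h : hamJacobiTerm hω hdeg x p σ = 0 by rw [h, smul_zero, smul_zero]
      by_cases hp : (p : ℕ) + 1 = 2
      · rw [hamJacobiTerm_last hω hdeg x p σ hp]
        -- The output of l_2 has degree 0, where l_1 vanishes by definition.
        refine hamDiff_of_mem_zero ?_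
        have h := hamBracket_mem_hamPart hω hdeg (n := p + 1) (by omega)
          fun a : Fin (p + 1) => x (σ ⟨a, by omega⟩)
        rwa [show (2 : ℤ) - ((p + 1 : ℕ) : ℤ) = 0 by rw [hp]; rfl] at h
      · exact hamJacobiTerm_of_ne hω hdeg x p σ hp (by omega)
    | r + 3, d, x, hx, hd =>
      have hX : ∀ i, dCE (contr (x i).1.2 ω) = 0 := fun i => dCE_contr_of_mem_ham (x i).2
      -- Only p = 1 (inner l_2) and p = r + 2 (outer l_1) survive; both signs (-1)^{i(j-1)} are +1.
      rw [Fintype.sum_eq_add (⟨1, by omega⟩ : Fin (r + 3)) ⟨r + 2, by omega⟩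
        (by rw [Ne, Fin.mk.injEq]; omega)]
      · have hlast : ∑ σ ∈ unshuffles (r + 3) (r + 2 + 1),
            (-1 : ℤ) ^ ((r + 2 + 1) * (r + 3 - (r + 2 + 1))) • koszulSign σ d •
              hamJacobiTerm hω hdeg x ⟨r + 2, by omega⟩ σ =
            hamDiff m ω (hamBracket hω hdeg (r + 3) x) := by
          rw [unshuffles_self, Finset.sum_singleton, koszulSign_one, one_smul, Nat.sub_self,
            mul_zero, pow_zero, one_smul]
          exact hamJacobiTerm_last hω hdeg x _ 1 rfl
        have htwo : ((∑ σ ∈ unshuffles (r + 3) (1 + 1),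
            (-1 : ℤ) ^ ((1 + 1) * (r + 3 - (1 + 1))) • koszulSign σ d •
              hamJacobiTerm hω hdeg x ⟨1, by omega⟩ σ : ham (m + 1) ω) :
                CE 𝕜 A × Derivation 𝕜 A A) =
            ∑ i : Fin (r + 2), ∑ j ≥ i, (-1 : ℤ) ^ ((i : ℕ) + j) •
              higherAlt ω (r + 2) (Fin.cons ⁅(x i.castSucc).1.2, (x j.succ).1.2⁆
                (j.removeNth (i.castSucc.removeNth fun a => (x a).1.2))) := by
          rw [sum_unshuffles_two (n := r + 1), Submodule.coe_sum]
          refine Finset.sum_congr rfl fun i _ => ?_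
          rw [Submodule.coe_sum]
          refine Finset.sum_congr rfl fun j hj => ?_
          rw [koszulSign_of_eq_zero _ hd, sign_twoShuffle, Units.smul_def,
            Submodule.coe_smul_of_tower, Submodule.coe_smul_of_tower,
            hamJacobiTerm_twoShuffle hω hdeg x (Finset.mem_Ici.1 hj), pow_mul, one_add_one_eq_two,
            neg_one_sq, one_pow, one_smul]
          congr 1
        refine Subtype.ext ?_
        refine (congrArg₂ (· + ·) htwo
          ((congrArg Subtype.val hlast).trans (hamDiff_hamBracket hω hdeg x))).trans ?_
        simp only [higherAlt_apply]
        refine Prod.ext ?_ ?_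
        -- The terms of l_{r+2} ∘ l_2 carry (-1)^{r+3} and those of d ∘ l_{r+3} carry (-1)^{r+4}, so
        -- they cancel pair by pair.
        · simp only [Prod.fst_add, Prod.fst_sum, Prod.smul_fst]
          rw [dCE_iterContr (fun a => (x a).1.2) hω hX, Finset.smul_sum, ← Finset.sum_add_distrib]
          refine Finset.sum_eq_zero fun i _ => ?_
          rw [Finset.smul_sum, ← Finset.sum_add_distrib]
          refine Finset.sum_eq_zero fun j _ => ?_
          rw [iterContr_succ, Fin.cons_zero, Fin.tail_cons, smul_comm, ← add_smul, pow_succ _ (r + 3),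
            mul_neg_one, add_neg_cancel, zero_smul]
        · simp only [Prod.snd_add, Prod.snd_sum, Prod.smul_snd, add_zero]
          exact sum_lieAlt_eq_zero fun a => (x a).1.2
      · rintro p ⟨hp1, hp2⟩
        refine Finset.sum_eq_zero fun σ _ => ?_
        rw [hamJacobiTerm_of_ne hω hdeg x p σ (fun h => hp2 (Fin.ext (by simpa using h)))
          (fun h => hp1 (Fin.ext h)), smul_zero, smul_zero]
  · push Not at hd
    obtain ⟨a, ha⟩ := hd
    have hsnd := snd_eq_zero_of_mem_hamPart ha (hx a)
    refine Finset.sum_eq_zero fun p _ => Finset.sum_eq_zero fun σ _ => ?_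
    suffices h : hamJacobiTerm hω hdeg x p σ = 0 by rw [h, smul_zero, smul_zero]
    rcases Nat.lt_or_ge n 2 with hn | hn
    · have hp : (p : ℕ) + 1 = n := by omega
      rw [hamJacobiTerm_last hω hdeg x p σ hp, hamBracket_of_eq_one hω hdeg (by omega),
        hamDiff_hamDiff]
    · exact hamJacobiTerm_of_snd_eq_zero hω hdeg hn x p σ a hsnd

/-- The `L∞`-algebra of observables of a closed form `ω` of degree `m + 2`. -/
def hamLInfty : LInftyAlgebra 𝕜 (hamGrading (m + 1) ω) where
  isInternal := isInternal_hamGrading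
  bracket := hamBracket hω hdeg
  bracket_zero := rfl
  degree := hamBracket_degree hω hdeg
  antisymm := hamBracket_antisymm hω hdeg
  jacobi := hamBracket_jacobi hω hdeg

theorem isObservablesBracket_hamBracket :
    IsObservablesBracket (m + 1) ω (hamLInfty hω hdeg).bracket where
  unary_neg := fun i hi x hx => hamDiff_of_mem_ne hi.ne hx
  unary_zero := fun x hx => hamDiff_of_mem_zero hx
  binary := fun x _ y _ => by
    refine (hamBracket_of_two_le hω hdeg le_rfl _).trans ?_
    rw [higherAlt_apply]
    refine Prod.ext ?_ rfl
    change (-1 : ℤ) ^ 3 • contr x.1.2 (contr y.1.2 ω) = _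
    simp [pow_succ]
  higher := fun n hn x _ => by
    refine (hamBracket_of_two_le hω hdeg (by omega) _).trans ?_
    rw [higherAlt_apply, lieAlt_of_ne (by omega)]
    rfl
  vanish := fun n hn x a i hi hx =>
    hamBracket_eq_zero hω hdeg hn x a (snd_eq_zero_of_mem_hamPart hi hx)

end Jacobi

/-! ### Iterated contractions inside a subspace -/

section ContractionMembership

variable {𝕜 A : Type*} [Field 𝕜] [CommRing A] [Algebra 𝕜 A] {ω : CE 𝕜 A}

/-- Only the innermost contraction is required to lie in S, not ω: for observables it equals -dα,
which is basic even if ω is not. -/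
theorem iterContr_mem_of_last {S : Submodule 𝕜 (CE 𝕜 A)} {n : ℕ}
    (X : Fin (n + 1) → Derivation 𝕜 A A) (hlast : contr (X (Fin.last n)) ω ∈ S)
    (hS : ∀ i, ∀ α ∈ S, contr (X i) α ∈ S) : iterContr X ω ∈ S := by
  induction n with
  | zero => exact hlast
  | succ n ih =>
    rw [iterContr_succ]
    exact hS 0 _ (ih (Fin.tail X) hlast fun i => hS i.succ)

/-- The string of contractions stays in S until X_a is inserted, which moves it to N, where it
remains. If X_a is innermost there is no form in S to start from, hence the separate condition
`ha'`. -/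
theorem iterContr_mem_N {S N : Submodule 𝕜 (CE 𝕜 A)} {n : ℕ}
    (X : Fin (n + 1) → Derivation 𝕜 A A) (hlast : contr (X (Fin.last n)) ω ∈ S)
    (hS : ∀ i, ∀ α ∈ S, contr (X i) α ∈ S) (hN : ∀ i, ∀ α ∈ N, contr (X i) α ∈ N) (a : Fin (n + 1))
    (ha : ∀ α ∈ S, contr (X a) α ∈ N) (ha' : a = Fin.last n → contr (X a) ω ∈ N) :
    iterContr X ω ∈ N := by
  induction n with
  | zero =>
    obtain rfl : a = Fin.last 0 := Fin.ext (by omega)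
    exact ha' rfl
  | succ n ih =>
    rw [iterContr_succ]
    cases a using Fin.cases with
    | zero => exact ha _ (iterContr_mem_of_last (Fin.tail X) hlast fun i => hS i.succ)
    | succ a =>
      exact hN 0 _ (ih (Fin.tail X) hlast (fun i => hS i.succ) (fun i => hN i.succ) a ha
        fun h => ha' (by rw [h, Fin.succ_last]))

end ContractionMembership

/-! ### Compatibility of the brackets with W and N -/

section ConstraintObservables

variable {𝕜 A : Type*} [Field 𝕜] [CharZero 𝕜] [CommRing A] [Algebra 𝕜 A] {m : ℕ} {ω : CE 𝕜 A}

/-- Formal in the Cartan calculus: ι_X ω = -dα inherits W or N from the Hamiltonian form α, and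
contraction with the other vector fields preserves it. The projection hypotheses let this be applied
to inhomogeneous elements. -/
theorem isConstraintLInfty_hamLInfty {C : ConstraintTriple 𝕜 A}
    {Y : ConstraintTriple 𝕜 (Derivation 𝕜 A A)} {V : ConstraintTriple 𝕜 (CE 𝕜 A)}
    (hY : IsStrongConstraintLieRinehart C Y) (hV : IsConstraintCartanCalculus C Y V)
    (hprojW : ∀ α ∈ V.W, ∀ n, ceProj n α ∈ V.W) (hprojN : ∀ α ∈ V.N, ∀ n, ceProj n α ∈ V.N)
    (hω : dCE ω = 0) (hdeg : ω ∈ cePart ((m : ℤ) + 2)) :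
    IsConstraintLInfty (hamLInfty hω hdeg) (hamTriple (m + 1) ω V Y) where
  le := fun x hx => ⟨hV.le hx.1, hY.le hx.2⟩
  graded_W := isGradedSubspace_hamGrading (S := V.W.prod Y.W)
    (fun x hx n => ⟨hprojW _ hx.1 n, Submodule.zero_mem _⟩)
    fun x hx => ⟨hprojW _ hx.1 m, hx.2⟩
  graded_N := isGradedSubspace_hamGrading (S := V.N.prod Y.N)
    (fun x hx n => ⟨hprojN _ hx.1 n, Submodule.zero_mem _⟩)
    fun x hx => ⟨hprojN _ hx.1 m, hx.2⟩
  bracket_W := by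
    intro n x hx
    have hc : ∀ a, contr (x a).1.2 ω ∈ V.W := fun a => by
      rw [ham_contr (x a).2]
      exact neg_mem (hV.d_W _ (hprojW _ (hx a).1 m))
    match n, x, hx, hc with
    | 0, _, _, _ => exact Submodule.zero_mem _
    | 1, x, hx, _ =>
      change (hamBracket hω hdeg 1 x : CE 𝕜 A × Derivation 𝕜 A A) ∈ V.W.prod Y.W
      rw [hamBracket_of_eq_one hω hdeg rfl, hamDiff_coe]
      exact ⟨hV.d_W _ (sub_mem (hx 0).1 (hprojW _ (hx 0).1 m)), Submodule.zero_mem _⟩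
    | n + 2, x, hx, hc =>
      change (hamBracket hω hdeg (n + 2) x : CE 𝕜 A × Derivation 𝕜 A A) ∈ V.W.prod Y.W
      rw [hamBracket_of_two_le hω hdeg (by omega), higherAlt_apply]
      have h : iterContr (fun a => (x a).1.2) ω ∈ V.W :=
        iterContr_mem_of_last _ (hc (Fin.last _)) fun i => hV.contr_W _ (hx i).2
      refine Submodule.mem_prod.2 ⟨zsmul_mem h _, ?_⟩
      cases n with
      | zero => exact hY.lie_W _ (hx 0).2 _ (hx 1).2
      | succ n =>
        rw [lieAlt_of_ne (by omega)]
        exact Submodule.zero_mem _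
  bracket_N := by
    intro n x hx a ha
    have hc : ∀ a, contr (x a).1.2 ω ∈ V.W := fun a => by
      rw [ham_contr (x a).2]
      exact neg_mem (hV.d_W _ (hprojW _ (hx a).1 m))
    have hca : contr (x a).1.2 ω ∈ V.N := by
      rw [ham_contr (x a).2]
      exact neg_mem (hV.d_N _ (hprojN _ ha.1 m))
    match n, x, hx, a, ha, hc, hca with
    | 0, _, _, a, _, _, _ => exact a.elim0
    | 1, x, hx, a, ha, _, _ =>
      obtain rfl : a = 0 := Subsingleton.elim _ _
      change (hamBracket hω hdeg 1 x : CE 𝕜 A × Derivation 𝕜 A A) ∈ V.N.prod Y.N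
      rw [hamBracket_of_eq_one hω hdeg rfl, hamDiff_coe]
      exact ⟨hV.d_N _ (sub_mem ha.1 (hprojN _ ha.1 m)), Submodule.zero_mem _⟩
    | n + 2, x, hx, a, ha, hc, hca =>
      change (hamBracket hω hdeg (n + 2) x : CE 𝕜 A × Derivation 𝕜 A A) ∈ V.N.prod Y.N
      rw [hamBracket_of_two_le hω hdeg (by omega), higherAlt_apply]
      have h : iterContr (fun a => (x a).1.2) ω ∈ V.N :=
        iterContr_mem_N (S := V.W) _ (hc (Fin.last _)) (fun i => hV.contr_W _ (hx i).2)
          (fun i => hV.contr_N_right _ (hx i).2) a (hV.contr_N_left _ ha.2) fun _ => hca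
      refine Submodule.mem_prod.2 ⟨zsmul_mem h _, ?_⟩
      cases n with
      | zero =>
        change ⁅(x 0).1.2, (x 1).1.2⁆ ∈ Y.N
        fin_cases a
        · rw [← lie_skew]
          exact neg_mem (hY.lie_N _ (hx 1).2 _ ha.2)
        · exact hY.lie_N _ (hx 0).2 _ ha.2
      | succ n =>
        rw [lieAlt_of_ne (by omega)]
        exact Submodule.zero_mem _

end ConstraintObservables

end ConstraintReduction

/-! ### Assembly of the theorem -/

theorem mainTheorem4 {𝕜 A : Type*} [Field 𝕜] [CharZero 𝕜] [CommRing A] [Algebra 𝕜 A]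
    (I : Ideal A) (F : Set (Derivation 𝕜 A A)) (hF : ∀ X ∈ F, ∀ a ∈ I, X a ∈ I)
    (k : ℕ) (hk : 1 ≤ k) (ω : Form 𝕜 A (k + 1)) (hω : ceDiff ω = 0)
    (hωF : ∀ X ∈ F, ∀ Z : Fin k → Derivation 𝕜 A A, (∀ i, ∀ a ∈ I, Z i a ∈ I) →
      ω (Matrix.vecCons X Z) ∈ I) :
    IsStrongConstraintLieRinehart (redAlg I F) (redLR I F) ∧
    IsConstraintCartanCalculus (redAlg I F) (redLR I F) (basicTriple I F) ∧
    (CE.of 𝕜 A (k + 1) ω ∈ (formTriple 𝕜 I).W →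
      ∀ X ∈ (redLR I F).N, contr X (CE.of 𝕜 A (k + 1) ω) ∈ (formTriple 𝕜 I).N) ∧
    ∃ L : LInftyAlgebra 𝕜 (hamGrading k (CE.of 𝕜 A (k + 1) ω)),
      IsObservablesBracket k (CE.of 𝕜 A (k + 1) ω) L.bracket ∧
      IsConstraintLInfty L
        (hamTriple k (CE.of 𝕜 A (k + 1) ω) (basicTriple I F) (redLR I F)) ∧
      ∃ Lred : LInftyAlgebra 𝕜
          ((hamTriple k (CE.of 𝕜 A (k + 1) ω) (basicTriple I F) (redLR I F)).redGrading
            (hamGrading k (CE.of 𝕜 A (k + 1) ω))),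
        ∀ (n : ℕ)
          (x : Fin n →
            (hamTriple k (CE.of 𝕜 A (k + 1) ω) (basicTriple I F) (redLR I F)).W)
          (y : (hamTriple k (CE.of 𝕜 A (k + 1) ω) (basicTriple I F) (redLR I F)).W),
          (y : ham k (CE.of 𝕜 A (k + 1) ω)) =
              L.bracket n (fun a => (x a : ham k (CE.of 𝕜 A (k + 1) ω))) →
            Lred.bracket n (fun a => Submodule.Quotient.mk (x a)) =
              Submodule.Quotient.mk y := by
  -- Here m = k - 1 is the degree of the Hamiltonian forms.
  obtain ⟨m, rfl⟩ := Nat.exists_eq_add_of_le' hk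
  have hclosed : dCE (CE.of 𝕜 A (m + 1 + 1) ω) = 0 := by rw [dCE_of, hω, map_zero]
  have hdeg : CE.of 𝕜 A (m + 1 + 1) ω ∈ cePart (𝕜 := 𝕜) ((m : ℤ) + 2) :=
    fun n hn => CE.comp_of_ne (by omega) ω
  have hY := isStrongConstraintLieRinehart_redLR hF
  have hV := isConstraintCartanCalculus_basicTriple hF
  have hL := isConstraintLInfty_hamLInfty hY hV (fun _ hα n => ceProj_mem_basic_W n hα)
    (fun _ hα n => ceProj_mem_form_N n hα) hclosed hdeg
  refine ⟨hY, hV, fun hωW X hX => ?_, hamLInfty hclosed hdeg,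
    isObservablesBracket_hamBracket hclosed hdeg, hL, (hamLInfty hclosed hdeg).reduction hL,
    (hamLInfty hclosed hdeg).reduction_bracket_mk hL⟩
  refine contr_mem_form_N_of_mem_symLR hF hclosed (fun X hX n Z hZ => ?_) hωW hX
  rw [contr_of_succ]
  -- The contraction ι_X ω is concentrated in degree k = m + 1, the only degree in which the
  -- condition on F says anything.
  by_cases h : m + 1 = n
  · subst h
    rw [CE.comp_of_same]
    exact hωF X hX Z fun i => mem_der_W.1 (hZ i)
  · rw [CE.comp_of_ne h]
    exact I.zero_mem
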